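/- Let $R=(V_R,E_R)$ and $B=(V_B,E_B)$ be two finite trees, whose vertex sets (and edge sets) may have any elements in common. Call an edge common if it belongs to $E_R\cap E_B$, and exclusive if it belongs to exactly one of $E_R$ and $E_B$. A drawing of a graph maps distinct vertices to distinct points of the plane and each edge to a simple curve that connects its endvertices and passes through no other vertex; the drawing is plane if any two distinct edges meet only at a common endvertex. A simultaneous embedding with fixed edges (SEFE) of $R$ and $B$ is a drawing of the union graph $(V_R\cup V_B,\,E_R\cup E_B)$ whose restrictions to $R$ and to $B$ are both plane drawings. Then there exists a SEFE of $R$ and $B$ in which every exclusive edge is a polygonal curve with exactly one bend, every common edge is a straight-line segment, and any two distinct exclusive edges cross at most four times; in fact any two distinct exclusive edges have at most four points in common, a common endvertex included. -/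

import Mathlib

/-- The plane, with real coordinates. -/
abbrev Plane : Type := ℝ × ℝ

/-- `A` is (the point set of) a simple curve that connects the points `p` and `q`. -/
def IsSimpleCurve (A : Set Plane) (p q : Plane) : Prop :=
  ∃ γ : Path p q, Function.Injective γ ∧ Set.range γ = A

/-- `A` is (the point set of) a polygonal curve from `p` to `q` with exactly one bend: two segments
meeting at a bend-point `b`. Since `p`, `b`, `q` are not collinear, the curve really bends at `b`. -/
def IsOneBendCurve (A : Set Plane) (p q : Plane) : Prop :=
  ∃ b : Plane, ¬ Collinear ℝ {p, b, q} ∧ A = segment ℝ p b ∪ segment ℝ b q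

/-- A placement of vertices as points and of edges as point sets of curves in the plane.
Only the values on the vertices and edges of the graph under consideration matter. -/
structure Placement (V : Type*) where
  /-- the point at which a vertex is placed -/
  point : V → Plane
  /-- the curve that represents an edge, as a set of points -/
  curve : Sym2 V → Set Plane

namespace Placement

variable {V : Type*}

/-- `Γ` is a drawing of the graph `G`: distinct vertices are at distinct points, every edge is a
simple curve connecting its endvertices, and no edge passes through a vertex that is not one of its
endvertices. Edges may intersect each other. -/
structure IsDrawing (Γ : Placement V) (G : (⊤ : SimpleGraph V).Subgraph) : Prop where
  injOn : Set.InjOn Γ.point G.verts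
  simple : ∀ u v : V, G.Adj u v → IsSimpleCurve (Γ.curve s(u, v)) (Γ.point u) (Γ.point v)
  avoid : ∀ e ∈ G.edgeSet, ∀ w ∈ G.verts, Γ.point w ∈ Γ.curve e → w ∈ e

/-- `Γ` is a plane drawing of the graph `G`: a drawing in which two distinct edges have no point in
common, except for a common endvertex. -/
structure IsPlaneDrawing (Γ : Placement V) (G : (⊤ : SimpleGraph V).Subgraph) : Prop
    extends IsDrawing Γ G where
  noCross : ∀ e ∈ G.edgeSet, ∀ f ∈ G.edgeSet, e ≠ f →
    ∀ x ∈ Γ.curve e ∩ Γ.curve f, ∃ v : V, v ∈ e ∧ v ∈ f ∧ x = Γ.point v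

/-- `Γ` is a simultaneous embedding with fixed edges of `R` and `B`: a drawing of the union graph
whose restrictions to `R` and to `B` are plane. Common vertices and common edges have a single
representation in `Γ`. -/
structure IsSefe (Γ : Placement V) (R B : (⊤ : SimpleGraph V).Subgraph) : Prop where
  union : Γ.IsDrawing (R ⊔ B)
  red : Γ.IsPlaneDrawing R
  blue : Γ.IsPlaneDrawing B

end Placement

/-- The common edges of `R` and `B`. -/
def commonEdges {V : Type*} (R B : (⊤ : SimpleGraph V).Subgraph) : Set (Sym2 V) :=
  R.edgeSet ∩ B.edgeSet

/-- The exclusive edges: the edges of `R` or `B` that are not common. -/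
def exclusiveEdges {V : Type*} (R B : (⊤ : SimpleGraph V).Subgraph) : Set (Sym2 V) :=
  (R.edgeSet ∪ B.edgeSet) \ commonEdges R B

/-!
The common graph of the two trees is a forest, and the drawing treats each of its components as a
block. The proof has a combinatorial and a geometric part.

*Combinatorics.* The vertices of a forest `T` can be placed on a line so that each component of a
given subforest `C` occupies an interval, in a prescribed order, and the edges of `T` outside `C`
form arcs above the line that do not cross (`exists_layout`). The induction also keeps a chosen
vertex `r` exposed, that is, below no arc: an edge `sv` that leaves the block of `r` and is nearest
to `r` on its side is removed, the part of `v` is laid out with `v` exposed and moved to the far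
end of the line, and the arc `sv` can be drawn again.
A first use of this fact, with `C` empty, orders each common component so that its edges do not
cross. A second and a third use give the order of the abscissas, for `R`, and of the ordinates, for
`B`, where the vertices of a common component appear in opposite orders. The offsets inside a block
are chosen so that the component lies on a strictly concave descending chain
(`exists_isGoodPosition`).

*Geometry.* The common edges are chords of these chains. An exclusive edge of `R` is a tent with
sides of slope `±σ`, where `σ` exceeds all differences of coordinates and grows with the width of
the tent. From every vertex, all other vertices and the chords lie below the cone in which tents
leave (`IsGoodPosition.lt_cone_of_mem_chord`), so that tents avoid them; nested tents are disjoint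
since the outer one is steeper (`eq_of_mem_nested_tents`). The exclusive edges of `B` are tents
after an exchange of the coordinates. A side of a tent of `R` is steep and a side of a tent of `B`
is flat, so they have at most one common point, which makes at most four for two edges.
-/

/-! ### Layouts of forests on a line -/

section Layout

variable {V : Type*}

/-- The position on a line of the element `x` of the block with rank `β x`, if every block is
given an interval of length `W` and `x` has offset `o x` inside its block. -/
def linePos (W : ℤ) (β o : V → ℤ) (x : V) : ℤ := W * β x + o x

/-- `β` ranks the components of `C` in such a way that the edges of `T` outside `C`, drawn as arcs
above a line on which the vertices have the positions `linePos W β o`, do not cross. -/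
structure IsLayout (T C : SimpleGraph V) (W : ℤ) (o β : V → ℤ) : Prop where
  block : ∀ x y, β x = β y ↔ C.Reachable x y
  noCross : ∀ a b c d, T.Adj a b → ¬ C.Adj a b → T.Adj c d → ¬ C.Adj c d →
    ¬ (linePos W β o a < linePos W β o c ∧ linePos W β o c < linePos W β o b ∧
      linePos W β o b < linePos W β o d)

/-- The vertex `r` is not below any of the arcs of a layout. -/
def IsExposedVertex (T C : SimpleGraph V) (W : ℤ) (o β : V → ℤ) (r : V) : Prop :=
  ∀ a b, T.Adj a b → ¬ C.Adj a b →
    ¬ (linePos W β o a < linePos W β o r ∧ linePos W β o r < linePos W β o b)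

theorem linePos_lt_of_lt {W : ℤ} {o β : V → ℤ} (ho : ∀ x, 0 ≤ o x ∧ o x < W) {x y : V}
    (h : β x < β y) : linePos W β o x < linePos W β o y := by
  have hx := ho x
  have hy := ho y
  unfold linePos
  nlinarith [mul_le_mul_of_nonneg_left (Int.add_one_le_of_lt h) (by omega : 0 ≤ W)]

theorem le_of_linePos_lt {W : ℤ} {o β : V → ℤ} (ho : ∀ x, 0 ≤ o x ∧ o x < W) {x y : V}
    (h : linePos W β o x < linePos W β o y) : β x ≤ β y := by
  by_contra! hlt
  exact absurd (linePos_lt_of_lt ho hlt) (by omega)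

theorem linePos_mirror (W : ℤ) (β o : V → ℤ) (x : V) :
    linePos W (fun y => -β y) (fun y => W - 1 - o y) x = W - 1 - linePos W β o x := by
  simp only [linePos]; ring

/-- Reversing the line turns a layout into a layout. -/
theorem IsLayout.mirror {T C : SimpleGraph V} {W : ℤ} {o β : V → ℤ} (h : IsLayout T C W o β) :
    IsLayout T C W (fun y => W - 1 - o y) (fun y => -β y) where
  block x y := by simpa using h.block x y
  noCross a b c d hab hab' hcd hcd' := by
    simp only [linePos_mirror]
    have := h.noCross d c b a hcd.symm (fun h => hcd' h.symm) hab.symm (fun h => hab' h.symm)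
    omega

theorem IsExposedVertex.mirror {T C : SimpleGraph V} {W : ℤ} {o β : V → ℤ} {r : V}
    (h : IsExposedVertex T C W o β r) :
    IsExposedVertex T C W (fun y => W - 1 - o y) (fun y => -β y) r := by
  intro a b hab hab'
  simp only [linePos_mirror]
  have := h b a hab.symm (fun h => hab' h.symm)
  omega

/-- If no edge of `T` leaves `S`, then two layouts of `T` can be combined: the part outside `S`
of the first one, followed on the line by the part inside `S` of the second one. -/
theorem IsLayout.combine [Finite V] {T C : SimpleGraph V} {W : ℤ} {o β₁ β₂ : V → ℤ}
    (hC : C ≤ T) (ho : ∀ x, 0 ≤ o x ∧ o x < W)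
    (h₁ : IsLayout T C W o β₁) (h₂ : IsLayout T C W o β₂) {S : Set V}
    (hS : ∀ x y, T.Adj x y → (x ∈ S ↔ y ∈ S)) :
    ∃ (N : ℤ) (β : V → ℤ), IsLayout T C W o β ∧ (∀ x ∉ S, β x = β₁ x) ∧
      (∀ x ∈ S, β x = β₂ x + N) ∧
      ∀ x ∉ S, ∀ y ∈ S, linePos W β o x < linePos W β o y := by
  classical
  obtain ⟨M₁, hM₁⟩ := (Set.finite_range β₁).bddAbove
  obtain ⟨M₂, hM₂⟩ := (Set.finite_range β₂).bddBelow
  have hM₁' : ∀ x, β₁ x ≤ M₁ := fun x => hM₁ ⟨x, rfl⟩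
  have hM₂' : ∀ x, M₂ ≤ β₂ x := fun x => hM₂ ⟨x, rfl⟩
  set β : V → ℤ := fun x => if x ∈ S then β₂ x + (M₁ - M₂ + 1) else β₁ x with hβ
  have hout : ∀ x ∉ S, β x = β₁ x := fun x hx => by simp [hβ, hx]
  have hin : ∀ x ∈ S, β x = β₂ x + (M₁ - M₂ + 1) := fun x hx => by simp [hβ, hx]
  have hlt : ∀ x ∉ S, ∀ y ∈ S, β x < β y := fun x hx y hy => by
    rw [hout x hx, hin y hy]
    have := hM₁' x
    have := hM₂' y
    omega
  have hpos : ∀ x ∉ S, ∀ y ∈ S, linePos W β o x < linePos W β o y := fun x hx y hy =>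
    linePos_lt_of_lt ho (hlt x hx y hy)
  have hreach : ∀ x y, C.Reachable x y → (x ∈ S ↔ y ∈ S) := by
    intro x y hxy
    rw [SimpleGraph.reachable_iff_reflTransGen] at hxy
    induction hxy with
    | refl => rfl
    | tail _ hbc ih => exact ih.trans (hS _ _ (hC hbc))
  have pout : ∀ x ∉ S, linePos W β o x = linePos W β₁ o x := fun x hx => by
    simp only [linePos, hout x hx]
  have pin : ∀ x ∈ S, linePos W β o x = linePos W β₂ o x + W * (M₁ - M₂ + 1) := fun x hx => by
    simp only [linePos, hin x hx]; ring
  refine ⟨_, β, ⟨fun x y => ?_, fun a b c d hab hab' hcd hcd' => ?_⟩, hout, hin, hpos⟩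
  · by_cases hx : x ∈ S <;> by_cases hy : y ∈ S
    · rw [hin x hx, hin y hy, ← h₂.block]; omega
    · exact iff_of_false (hlt y hy x hx).ne' fun h => hy ((hreach x y h).1 hx)
    · exact iff_of_false (hlt x hx y hy).ne fun h => hx ((hreach x y h).2 hy)
    · rw [hout x hx, hout y hy, ← h₁.block]
  · rintro ⟨hac, hcb, hbd⟩
    by_cases ha : a ∈ S
    · have hb := (hS _ _ hab).1 ha
      by_cases hc : c ∈ S
      · have hd := (hS _ _ hcd).1 hc
        rw [pin a ha, pin c hc] at hac
        rw [pin c hc, pin b hb] at hcb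
        rw [pin d hd, pin b hb] at hbd
        exact h₂.noCross a b c d hab hab' hcd hcd' ⟨by omega, by omega, by omega⟩
      · exact absurd (hpos c hc a ha) (by omega)
    · have hb := mt (hS _ _ hab).2 ha
      by_cases hc : c ∈ S
      · exact absurd (hpos b hb c hc) (by omega)
      · have hd := mt (hS _ _ hcd).2 hc
        rw [pout a ha, pout c hc] at hac
        rw [pout c hc, pout b hb] at hcb
        rw [pout d hd, pout b hb] at hbd
        exact h₁.noCross a b c d hab hab' hcd hcd' ⟨hac, hcb, hbd⟩

/-- The induction step: let `s` be the first vertex not before `r` in the block of `r` that has an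
edge `sv` outside `C`. Cut the forest at `sv`, expose `r` in one part and `v` in the other part,
and put the part of `v` to the right of everything else. The arc from `s` to `v` can then be added,
since a vertex of an arc that covers `s` but not `r` would be an earlier choice for `s`. -/
theorem exists_layout_step [Finite V] {T C : SimpleGraph V} {W : ℤ} {o : V → ℤ}
    (hT : T.IsAcyclic) (hC : C ≤ T) (ho : ∀ x, 0 ≤ o x ∧ o x < W)
    (ih : ∀ T' < T, C ≤ T' → ∀ r, ∃ β, IsLayout T' C W o β ∧ IsExposedVertex T' C W o β r)
    {r : V} (hr : ∃ s v, C.Reachable r s ∧ o r ≤ o s ∧ T.Adj s v ∧ ¬ C.Adj s v) :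
    ∃ β, IsLayout T C W o β ∧ IsExposedVertex T C W o β r := by
  obtain ⟨s, ⟨v, hrs, hors, hsv, hsv'⟩, hmin⟩ := Set.exists_min_image
    {s | ∃ v, C.Reachable r s ∧ o r ≤ o s ∧ T.Adj s v ∧ ¬ C.Adj s v} o (Set.toFinite _) hr
  set T' := T.deleteEdges {s(s, v)} with hT'
  have hle : T' ≤ T := T.deleteEdges_le _
  have hlt : T' < T := lt_of_le_of_ne hle fun h => by
    have : T'.Adj s v := by rw [h]; exact hsv
    simp [hT'] at this
  have hCT' : C ≤ T' := by
    intro x y hxy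
    simp only [hT', SimpleGraph.deleteEdges_adj, Set.mem_singleton_iff]
    refine ⟨hC hxy, fun h => hsv' ?_⟩
    rwa [← SimpleGraph.mem_edgeSet, ← h, SimpleGraph.mem_edgeSet]
  have hadj : ∀ x y, T.Adj x y → T'.Adj x y ∨ (x = s ∧ y = v) ∨ (x = v ∧ y = s) := by
    intro x y hxy
    by_cases h : s(x, y) = s(s, v)
    · right; simpa using h
    · left; simpa [hT', hxy] using h
  obtain ⟨β₁, h₁, e₁⟩ := ih T' hlt hCT' r
  obtain ⟨β₂, h₂, e₂⟩ := ih T' hlt hCT' v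
  set S : Set V := {x | T'.Reachable v x} with hSdef
  have hvS : v ∈ S := SimpleGraph.Reachable.refl v
  have hsS : s ∉ S := fun h =>
    SimpleGraph.isAcyclic_iff_forall_isBridge.1 hT (e := s(s, v)) hsv h.symm
  have hrS : r ∉ S := fun h => hsS (SimpleGraph.Reachable.trans h (hrs.mono hCT'))
  have hS : ∀ x y, T'.Adj x y → (x ∈ S ↔ y ∈ S) := fun x y hxy =>
    ⟨fun h => SimpleGraph.Reachable.trans h hxy.reachable,
      fun h => SimpleGraph.Reachable.trans h hxy.symm.reachable⟩
  obtain ⟨N, β, hβ, hout, hin, hpos⟩ := h₁.combine hCT' ho h₂ hS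
  have pout : ∀ x ∉ S, linePos W β o x = linePos W β₁ o x := fun x hx => by
    simp only [linePos, hout x hx]
  have pin : ∀ x ∈ S, linePos W β o x = linePos W β₂ o x + W * N := fun x hx => by
    simp only [linePos, hin x hx]; ring
  have hblock : β r = β s := (hβ.block r s).2 hrs
  have hprs : linePos W β o r ≤ linePos W β o s := by simp only [linePos, hblock]; omega
  have hpsv := hpos s hsS v hvS
  have hexp : ∀ a b, T'.Adj a b → ¬ C.Adj a b →
      ¬ (linePos W β o a < linePos W β o r ∧ linePos W β o r < linePos W β o b) := by
    rintro a b hab hab' ⟨har, hrb⟩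
    have ha : a ∉ S := fun h => absurd (hpos r hrS a h) (by omega)
    have hb := mt (hS _ _ hab).2 ha
    rw [pout a ha, pout r hrS] at har
    rw [pout b hb, pout r hrS] at hrb
    exact e₁ a b hab hab' ⟨har, hrb⟩
  refine ⟨β, ⟨hβ.block, fun a b c d hab hab' hcd hcd' => ?_⟩, fun a b hab hab' => ?_⟩
  · rintro ⟨hac, hcb, hbd⟩
    rcases hadj a b hab with hab₁ | ⟨rfl, rfl⟩ | ⟨rfl, rfl⟩
    · rcases hadj c d hcd with hcd₁ | ⟨rfl, rfl⟩ | ⟨rfl, rfl⟩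
      · exact hβ.noCross a b c d hab₁ hab' hcd₁ hcd' ⟨hac, hcb, hbd⟩
      · -- the arc `ab` covers `s = c`, hence not `r`, so that `a` competes with `s`
        have hra : linePos W β o r ≤ linePos W β o a := by
          by_contra! h
          exact hexp a b hab₁ hab' ⟨h, by omega⟩
        have hβa : β a = β r := by
          refine le_antisymm (hblock ▸ le_of_linePos_lt ho hac) ?_
          by_contra! h
          exact absurd (linePos_lt_of_lt ho h) (by omega)
        have hoa : o r ≤ o a := by
          simp only [linePos, hβa] at hra; omega
        have hoa' : o a < o c := by
          simp only [linePos, hβa, hblock] at hac; omega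
        have := hmin a ⟨b, (hβ.block r a).1 hβa.symm, hoa, hab, hab'⟩
        omega
      · omega
    · rcases hadj c d hcd with hcd₁ | ⟨rfl, rfl⟩ | ⟨rfl, rfl⟩
      · -- the arc `cd` covers the vertex `v = b`, which is exposed on its side
        have hd : d ∈ S := by
          by_contra h
          exact absurd (hpos d h b hvS) (by omega)
        have hc := (hS _ _ hcd₁).2 hd
        rw [pin c hc, pin b hvS] at hcb
        rw [pin d hd, pin b hvS] at hbd
        exact e₂ c d hcd₁ hcd' ⟨by omega, by omega⟩
      · omega
      · omega
    · omega
  · rintro ⟨har, hrb⟩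
    rcases hadj a b hab with hab₁ | ⟨rfl, rfl⟩ | ⟨rfl, rfl⟩
    · exact hexp a b hab₁ hab' ⟨har, hrb⟩
    · omega
    · omega

/-- Every forest has, for prescribed orders inside the components of a subforest `C`, a layout that
keeps the components of `C` together and exposes a given vertex `r`. -/
theorem exists_layout [Finite V] {C : SimpleGraph V} {W : ℤ} {o : V → ℤ}
    (ho : ∀ x, 0 ≤ o x ∧ o x < W) (T : SimpleGraph V) (hT : T.IsAcyclic) (hC : C ≤ T) (r : V) :
    ∃ β, IsLayout T C W o β ∧ IsExposedVertex T C W o β r := by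
  induction T using WellFoundedLT.induction generalizing r with
  | ind T ih =>
  have ih' : ∀ T' < T, C ≤ T' → ∀ r, ∃ β, IsLayout T' C W o β ∧ IsExposedVertex T' C W o β r :=
    fun T' hlt hC' r => ih T' hlt (hT.anti hlt.le) hC' r
  have main : ∀ r, (∃ s v, C.Reachable r s ∧ T.Adj s v ∧ ¬ C.Adj s v) →
      ∃ β, IsLayout T C W o β ∧ IsExposedVertex T C W o β r := by
    rintro r ⟨s, v, hrs, hsv, hsv'⟩
    rcases le_total (o r) (o s) with h | h
    · exact exists_layout_step hT hC ho ih' ⟨s, v, hrs, h, hsv, hsv'⟩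
    · obtain ⟨β, hβ, hβ'⟩ := exists_layout_step (W := W) (o := fun y => W - 1 - o y) hT hC
        (fun x => by have := ho x; omega) (fun T' hlt hC' r => by
          obtain ⟨β, hβ, hβ'⟩ := ih' T' hlt hC' r
          exact ⟨_, hβ.mirror, hβ'.mirror⟩)
        ⟨s, v, hrs, by omega, hsv, hsv'⟩
      have hm := hβ.mirror
      have hm' := hβ'.mirror
      simp only [sub_sub_cancel] at hm hm'
      exact ⟨_, hm, hm'⟩
  by_cases hr : ∃ s v, C.Reachable r s ∧ T.Adj s v ∧ ¬ C.Adj s v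
  · exact main r hr
  push Not at hr
  -- no arc is incident to the block of `r`, so this block may be moved to the left end
  obtain ⟨β₀, hβ₀⟩ : ∃ β, IsLayout T C W o β := by
    by_cases hE : ∃ s v, T.Adj s v ∧ ¬ C.Adj s v
    · obtain ⟨s, v, hsv, hsv'⟩ := hE
      obtain ⟨β, hβ, -⟩ := main s ⟨s, v, SimpleGraph.Reachable.refl s, hsv, hsv'⟩
      exact ⟨β, hβ⟩
    · push Not at hE
      obtain ⟨n, ⟨f⟩⟩ := Finite.exists_equiv_fin C.ConnectedComponent
      refine ⟨fun x => (f (C.connectedComponentMk x) : ℕ), fun x y => ?_,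
        fun a b c d hab hab' => absurd (hE a b hab) hab'⟩
      simp [Fin.val_inj, SimpleGraph.ConnectedComponent.eq]
  have hS : ∀ x y, T.Adj x y → (x ∈ {x | ¬ C.Reachable r x} ↔ y ∈ {x | ¬ C.Reachable r x}) := by
    intro x y hxy
    refine not_congr ⟨fun h => ?_, fun h => ?_⟩
    · exact h.trans (hr x y h hxy).reachable
    · exact h.trans (hr y x h hxy.symm).reachable
  obtain ⟨N, β, hβ, -, -, hpos⟩ := hβ₀.combine hC ho hβ₀ hS
  refine ⟨β, hβ, fun a b hab hab' ⟨har, _⟩ => ?_⟩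
  by_cases ha : C.Reachable r a
  · exact hab' (hr a b ha hab)
  · exact absurd (hpos r (by simp) a ha) (by omega)

end Layout

/-! ### Coordinates for two trees -/

section Coordinates

variable {V : Type*}

theorem isAcyclic_spanningCoe {G : SimpleGraph V} {H : G.Subgraph} (h : H.coe.IsAcyclic) :
    H.spanningCoe.IsAcyclic := by
  rw [SimpleGraph.isAcyclic_iff_forall_isBridge] at h ⊢
  intro e
  induction e with | _ u v
  intro huv hreach
  have huv' : H.Adj u v := huv
  have key : ∀ x, (H.spanningCoe.deleteEdges {s(u, v)}).Reachable u x → ∃ hx : x ∈ H.verts,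
      (H.coe.deleteEdges {s(⟨u, huv'.fst_mem⟩, ⟨v, huv'.snd_mem⟩)}).Reachable
        ⟨u, huv'.fst_mem⟩ ⟨x, hx⟩ := by
    intro x hx
    rw [SimpleGraph.reachable_iff_reflTransGen] at hx
    induction hx with
    | refl => exact ⟨huv'.fst_mem, SimpleGraph.Reachable.refl _⟩
    | @tail b c _ hbc ih =>
      obtain ⟨hb, ih⟩ := ih
      rw [SimpleGraph.deleteEdges_adj] at hbc
      have hbc' : H.Adj b c := hbc.1
      refine ⟨hbc'.snd_mem, ih.trans (SimpleGraph.Adj.reachable ?_)⟩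
      rw [SimpleGraph.deleteEdges_adj]
      refine ⟨hbc', fun h => hbc.2 ?_⟩
      simpa using h
  obtain ⟨hv, hv'⟩ := key v hreach
  exact h (e := s(⟨u, huv'.fst_mem⟩, ⟨v, huv'.snd_mem⟩)) huv' hv'

/-- Coordinates of the vertices of `R` and `B` for which the straight-line drawing of the common
edges can be completed by tents over the `x`-axis for the exclusive edges of `R`, and by tents over
the `y`-axis for those of `B`. -/
structure IsGoodPosition (R B : (⊤ : SimpleGraph V).Subgraph) (X Y : V → ℝ) : Prop where
  sepX : ∀ u ∈ R.verts ∪ B.verts, ∀ v ∈ R.verts ∪ B.verts, u ≠ v → 1 ≤ |X u - X v|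
  sepY : ∀ u ∈ R.verts ∪ B.verts, ∀ v ∈ R.verts ∪ B.verts, u ≠ v → 1 ≤ |Y u - Y v|
  /-- A common edge descends to the right. -/
  desc : ∀ p q, R.Adj p q → B.Adj p q → X p < X q → Y q < Y p
  /-- A vertex that lies between the ends of a common edge in one of the two directions lies
  between them in both directions, and is above the edge. -/
  above : ∀ p q, R.Adj p q → B.Adj p q → X p < X q → ∀ u ∈ R.verts ∪ B.verts,
    ((X u ≤ X p ∨ X q ≤ X u) ∧ (Y u ≤ Y q ∨ Y p ≤ Y u)) ∨
    (X p < X u ∧ X u < X q ∧ Y q < Y u ∧ Y u < Y p ∧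
      (X u - X p) * (Y q - Y p) < (Y u - Y p) * (X q - X p))
  noCrossCommon : ∀ a b c d, R.Adj a b → B.Adj a b → R.Adj c d → B.Adj c d →
    ¬ (X a < X c ∧ X c < X b ∧ X b < X d)
  noCrossRed : ∀ a b c d, R.Adj a b → ¬ B.Adj a b → R.Adj c d → ¬ B.Adj c d →
    ¬ (X a < X c ∧ X c < X b ∧ X b < X d)
  noCrossBlue : ∀ a b c d, B.Adj a b → ¬ R.Adj a b → B.Adj c d → ¬ R.Adj c d →
    ¬ (Y a < Y c ∧ Y c < Y b ∧ Y b < Y d)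

theorem linePos_injective {W : ℤ} {β o : V → ℤ} (ho : ∀ x, 0 ≤ o x ∧ o x < W)
    (hinj : Function.Injective o) : Function.Injective (linePos W β o) := by
  intro x y h
  rcases lt_trichotomy (β x) (β y) with hlt | heq | hlt
  · exact absurd (linePos_lt_of_lt ho hlt) (by omega)
  · exact hinj (by simp only [linePos, heq] at h; omega)
  · exact absurd (linePos_lt_of_lt ho hlt) (by omega)

theorem le_or_le_of_linePos {W : ℤ} {β o : V → ℤ} (ho : ∀ x, 0 ≤ o x ∧ o x < W) {p q u : V}
    (hpq : β p = β q) (hu : β p ≠ β u) :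
    linePos W β o u ≤ linePos W β o p ∧ linePos W β o u ≤ linePos W β o q ∨
      linePos W β o p ≤ linePos W β o u ∧ linePos W β o q ≤ linePos W β o u := by
  rcases lt_or_gt_of_ne hu with h | h
  · exact Or.inr ⟨(linePos_lt_of_lt ho h).le, (linePos_lt_of_lt ho (hpq ▸ h)).le⟩
  · exact Or.inl ⟨(linePos_lt_of_lt ho h).le, (linePos_lt_of_lt ho (hpq ▸ h)).le⟩

/-- Let `o` be an order for which the arcs of all edges of `R` are free of crossings. In both
directions, every component of the common graph occupies an interval, in the order `o`
horizontally and in the opposite order vertically. With the offsets `o` and `K² - o²` it becomes a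
strictly concave descending chain. -/
theorem exists_isGoodPosition (R B : (⊤ : SimpleGraph V).Subgraph)
    (hRfin : R.verts.Finite) (hBfin : B.verts.Finite)
    (hR : R.coe.IsTree) (hB : B.coe.IsTree) :
    ∃ X Y : V → ℝ, IsGoodPosition R B X Y := by
  set U : Set V := R.verts ∪ B.verts with hU
  have : Finite U := (hRfin.union hBfin).to_subtype
  set R' : SimpleGraph U := R.spanningCoe.induce U with hR'
  set B' : SimpleGraph U := B.spanningCoe.induce U with hB'
  have hRadj : ∀ a b : U, R'.Adj a b ↔ R.Adj a b := fun a b => Iff.rfl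
  have hBadj : ∀ a b : U, B'.Adj a b ↔ B.Adj a b := fun a b => Iff.rfl
  have aR : R'.IsAcyclic := (isAcyclic_spanningCoe hR.isAcyclic).induce U
  have aB : B'.IsAcyclic := (isAcyclic_spanningCoe hB.isAcyclic).induce U
  obtain ⟨r⟩ : Nonempty U := by
    obtain ⟨⟨x, hx⟩⟩ := hR.connected.nonempty
    exact ⟨⟨x, Or.inl hx⟩⟩
  obtain ⟨β₀, h₀, -⟩ := exists_layout (C := ⊥) (W := 1) (o := fun _ : U => 0)
    (fun _ => by norm_num) R' aR bot_le r
  have inj₀ : Function.Injective β₀ := fun x y h => by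
    simpa [SimpleGraph.reachable_bot] using (h₀.block x y).1 h
  obtain ⟨m, hm⟩ := (Set.finite_range β₀).bddBelow
  obtain ⟨M, hM⟩ := (Set.finite_range β₀).bddAbove
  have hm' : ∀ x, m ≤ β₀ x := fun x => hm ⟨x, rfl⟩
  have hM' : ∀ x, β₀ x ≤ M := fun x => hM ⟨x, rfl⟩
  obtain ⟨K, hK⟩ : ∃ K, K = M - m := ⟨_, rfl⟩
  obtain ⟨o, ho⟩ : ∃ o : U → ℤ, ∀ x, o x = β₀ x - m := ⟨_, fun _ => rfl⟩
  have ho₁ : ∀ x, 0 ≤ o x ∧ o x < K + 1 := fun x => by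
    have := hm' x
    have := hM' x
    have := ho x
    omega
  have injo : Function.Injective o := fun x y h => inj₀ (by rw [ho, ho] at h; omega)
  have nco : ∀ a b c d, R'.Adj a b → R'.Adj c d → ¬ (o a < o c ∧ o c < o b ∧ o b < o d) := by
    intro a b c d hab hcd h
    simp only [ho] at h
    refine h₀.noCross a b c d hab (by simp) hcd (by simp) ?_
    simp only [linePos]
    omega
  -- `o'` reverses `o`, and it is strictly concave as a function of `o`
  obtain ⟨o', ho'⟩ : ∃ o' : U → ℤ, ∀ x, o' x = K ^ 2 - o x ^ 2 := ⟨_, fun _ => rfl⟩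
  have ho'₁ : ∀ x, 0 ≤ o' x ∧ o' x < K ^ 2 + 1 := fun x => by
    obtain ⟨h₁, h₂⟩ := ho₁ x
    rw [ho']
    constructor <;> nlinarith
  have o'lt : ∀ x y, o' x < o' y ↔ o y < o x := fun x y => by
    rw [ho', ho', sub_lt_sub_iff_left, sq_lt_sq₀ (ho₁ y).1 (ho₁ x).1]
  have injo' : Function.Injective o' := fun x y h => by
    have h₁ := o'lt x y
    have h₂ := o'lt y x
    exact injo (by omega)
  obtain ⟨βR, hβR, -⟩ := exists_layout ho₁ R' aR (inf_le_left : R' ⊓ B' ≤ R') r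
  obtain ⟨βB, hβB, -⟩ := exists_layout ho'₁ B' aB (inf_le_right : R' ⊓ B' ≤ B') r
  obtain ⟨x, hx⟩ : ∃ x, x = linePos (K + 1) βR o := ⟨_, rfl⟩
  obtain ⟨y, hy⟩ : ∃ y, y = linePos (K ^ 2 + 1) βB o' := ⟨_, rfl⟩
  have injx : Function.Injective x := hx ▸ linePos_injective ho₁ injo
  have injy : Function.Injective y := hy ▸ linePos_injective ho'₁ injo'
  have hxo : ∀ u v, (R' ⊓ B').Reachable u v → x u - x v = o u - o v := fun u v huv => by
    rw [hx]
    simp only [linePos, (hβR.block u v).2 huv]; ring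
  have hyo : ∀ u v, (R' ⊓ B').Reachable u v → y u - y v = o' u - o' v := fun u v huv => by
    rw [hy]
    simp only [linePos, (hβB.block u v).2 huv]; ring
  have sep : ∀ z : U → ℤ, Function.Injective z → ∀ u v, u ≠ v → 1 ≤ |z u - z v| :=
    fun z hz u v huv => Int.one_le_abs (sub_ne_zero.2 fun h => huv (hz h))
  have desc : ∀ p q, R'.Adj p q → B'.Adj p q → x p < x q → y q < y p := by
    intro p q h₁ h₂ hpq
    have hr : (R' ⊓ B').Reachable q p := (SimpleGraph.Adj.reachable (G := R' ⊓ B') ⟨h₁, h₂⟩).symm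
    have e₁ := hxo q p hr
    have e₂ := hyo q p hr
    have := (o'lt q p).2 (by omega)
    omega
  have above : ∀ p q, R'.Adj p q → B'.Adj p q → x p < x q → ∀ u,
      ((x u ≤ x p ∨ x q ≤ x u) ∧ (y u ≤ y q ∨ y p ≤ y u)) ∨
      (x p < x u ∧ x u < x q ∧ y q < y u ∧ y u < y p ∧
        (x u - x p) * (y q - y p) < (y u - y p) * (x q - x p)) := by
    intro p q h₁ h₂ hpq u
    have hr : (R' ⊓ B').Reachable q p := (SimpleGraph.Adj.reachable (G := R' ⊓ B') ⟨h₁, h₂⟩).symm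
    by_cases hu : (R' ⊓ B').Reachable u p
    · have e₁ := hxo q p hr
      have e₂ := hyo q p hr
      have e₃ := hxo u p hu
      have e₄ := hyo u p hu
      have l₁ := o'lt q u
      have l₂ := o'lt u p
      by_cases hb : o p < o u ∧ o u < o q
      · right
        refine ⟨by omega, by omega, by omega, by omega, ?_⟩
        rw [e₁, e₂, e₃, e₄, ho', ho', ho']
        nlinarith [mul_pos (mul_pos (sub_pos.2 hb.1) (sub_pos.2 hb.2))
          (sub_pos.2 (hb.1.trans hb.2))]
      · left
        have := o'lt u q
        have := o'lt p u
        constructor <;> omega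
    · left
      have k₁ := le_or_le_of_linePos (u := u) ho₁ ((hβR.block p q).2 hr.symm)
        (fun h => hu ((hβR.block u p).1 h.symm))
      have k₂ := le_or_le_of_linePos (u := u) ho'₁ ((hβB.block p q).2 hr.symm)
        (fun h => hu ((hβB.block u p).1 h.symm))
      rw [← hx] at k₁
      rw [← hy] at k₂
      omega
  have ncC : ∀ a b c d, R'.Adj a b → B'.Adj a b → R'.Adj c d → B'.Adj c d →
      ¬ (x a < x c ∧ x c < x b ∧ x b < x d) := by
    rintro a b c d h₁ h₂ h₃ h₄ ⟨hac, hcb, hbd⟩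
    have hab : (R' ⊓ B').Reachable a b := SimpleGraph.Adj.reachable ⟨h₁, h₂⟩
    have hcd : (R' ⊓ B').Reachable c d := SimpleGraph.Adj.reachable ⟨h₃, h₄⟩
    have hca : (R' ⊓ B').Reachable c a := by
      refine (hβR.block c a).1 (le_antisymm ?_ ?_)
      · rw [(hβR.block a b).2 hab]
        exact le_of_linePos_lt ho₁ (hx ▸ hcb)
      · exact le_of_linePos_lt ho₁ (hx ▸ hac)
    have e₁ := hxo a b hab
    have e₂ := hxo c a hca
    have e₃ := hxo c d hcd
    exact nco a b c d h₁ h₃ ⟨by omega, by omega, by omega⟩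
  have ncR : ∀ a b c d, R'.Adj a b → ¬ B'.Adj a b → R'.Adj c d → ¬ B'.Adj c d →
      ¬ (x a < x c ∧ x c < x b ∧ x b < x d) := by
    intro a b c d h₁ h₂ h₃ h₄
    rw [hx]
    exact hβR.noCross a b c d h₁ (fun h => h₂ h.2) h₃ (fun h => h₄ h.2)
  have ncB : ∀ a b c d, B'.Adj a b → ¬ R'.Adj a b → B'.Adj c d → ¬ R'.Adj c d →
      ¬ (y a < y c ∧ y c < y b ∧ y b < y d) := by
    intro a b c d h₁ h₂ h₃ h₄
    rw [hy]
    exact hβB.noCross a b c d h₁ (fun h => h₂ h.1) h₃ (fun h => h₄ h.1)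
  obtain ⟨X, hX⟩ : ∃ X : V → ℝ, ∀ u : U, X u = x u :=
    ⟨Function.extend Subtype.val (fun u => (x u : ℝ)) 0,
      fun u => Subtype.val_injective.extend_apply _ _ u⟩
  obtain ⟨Y, hY⟩ : ∃ Y : V → ℝ, ∀ u : U, Y u = y u :=
    ⟨Function.extend Subtype.val (fun u => (y u : ℝ)) 0,
      fun u => Subtype.val_injective.extend_apply _ _ u⟩
  have hl : ∀ {u v}, R.Adj u v → u ∈ U ∧ v ∈ U := fun h => ⟨Or.inl h.fst_mem, Or.inl h.snd_mem⟩
  have hl' : ∀ {u v}, B.Adj u v → u ∈ U ∧ v ∈ U := fun h => ⟨Or.inr h.fst_mem, Or.inr h.snd_mem⟩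
  refine ⟨X, Y, ?_, ?_, ?_, ?_, ?_, ?_, ?_⟩
  · intro u hu v hv huv
    have := sep x injx ⟨u, hu⟩ ⟨v, hv⟩ (by simpa using huv)
    rw [hX ⟨u, hu⟩, hX ⟨v, hv⟩]
    exact_mod_cast this
  · intro u hu v hv huv
    have := sep y injy ⟨u, hu⟩ ⟨v, hv⟩ (by simpa using huv)
    rw [hY ⟨u, hu⟩, hY ⟨v, hv⟩]
    exact_mod_cast this
  · intro p q h₁ h₂
    have := desc ⟨p, (hl h₁).1⟩ ⟨q, (hl h₁).2⟩ h₁ h₂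
    rw [hX ⟨p, (hl h₁).1⟩, hX ⟨q, (hl h₁).2⟩, hY ⟨p, (hl h₁).1⟩, hY ⟨q, (hl h₁).2⟩]
    exact_mod_cast this
  · intro p q h₁ h₂ hpq u hu
    have := above ⟨p, (hl h₁).1⟩ ⟨q, (hl h₁).2⟩ h₁ h₂
    rw [hX ⟨p, (hl h₁).1⟩, hX ⟨q, (hl h₁).2⟩] at hpq
    have := this (by exact_mod_cast hpq) ⟨u, hu⟩
    rw [hX ⟨p, (hl h₁).1⟩, hX ⟨q, (hl h₁).2⟩, hY ⟨p, (hl h₁).1⟩, hY ⟨q, (hl h₁).2⟩,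
      hX ⟨u, hu⟩, hY ⟨u, hu⟩]
    exact_mod_cast this
  · intro a b c d h₁ h₂ h₃ h₄
    have := ncC ⟨a, (hl h₁).1⟩ ⟨b, (hl h₁).2⟩ ⟨c, (hl h₃).1⟩ ⟨d, (hl h₃).2⟩ h₁ h₂ h₃ h₄
    rw [hX ⟨a, (hl h₁).1⟩, hX ⟨b, (hl h₁).2⟩, hX ⟨c, (hl h₃).1⟩, hX ⟨d, (hl h₃).2⟩]
    exact_mod_cast this
  · intro a b c d h₁ h₂ h₃ h₄
    have := ncR ⟨a, (hl h₁).1⟩ ⟨b, (hl h₁).2⟩ ⟨c, (hl h₃).1⟩ ⟨d, (hl h₃).2⟩ h₁ h₂ h₃ h₄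
    rw [hX ⟨a, (hl h₁).1⟩, hX ⟨b, (hl h₁).2⟩, hX ⟨c, (hl h₃).1⟩, hX ⟨d, (hl h₃).2⟩]
    exact_mod_cast this
  · intro a b c d h₁ h₂ h₃ h₄
    have := ncB ⟨a, (hl' h₁).1⟩ ⟨b, (hl' h₁).2⟩ ⟨c, (hl' h₃).1⟩ ⟨d, (hl' h₃).2⟩ h₁ h₂ h₃ h₄
    rw [hY ⟨a, (hl' h₁).1⟩, hY ⟨b, (hl' h₁).2⟩, hY ⟨c, (hl' h₃).1⟩, hY ⟨d, (hl' h₃).2⟩]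
    exact_mod_cast this

end Coordinates

/-! ### Simple curves with one bend -/

section Curves

theorem injective_path_trans {E : Type*} [TopologicalSpace E] {p b q : E} {γ : Path p b}
    {δ : Path b q} (hγ : Function.Injective γ) (hδ : Function.Injective δ)
    (h : Set.range γ ∩ Set.range δ ⊆ {b}) : Function.Injective (γ.trans δ) := by
  have key : ∀ s t, γ s = δ t → s = 1 ∧ t = 0 := by
    intro s t hst
    have hb : γ s = b := h ⟨⟨s, rfl⟩, ⟨t, hst.symm⟩⟩
    exact ⟨hγ (hb.trans γ.target.symm), hδ ((hst.symm.trans hb).trans δ.source.symm)⟩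
  intro s t hst
  rw [Path.trans_apply, Path.trans_apply] at hst
  split_ifs at hst with hs ht ht
  · have := congrArg Subtype.val (hγ hst)
    exact Subtype.ext (by simpa using this)
  · have := congrArg Subtype.val (key _ _ hst).2
    simp only [Set.Icc.coe_zero] at this
    exact absurd (by linarith) ht
  · have := congrArg Subtype.val (key _ _ hst.symm).2
    simp only [Set.Icc.coe_zero] at this
    exact absurd (by linarith) hs
  · have := congrArg Subtype.val (hδ hst)
    exact Subtype.ext (by simpa using this)

theorem injective_path_segment {p q : Plane} (h : p ≠ q) :
    Function.Injective (Path.segment p q) := by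
  intro s t hst
  exact Subtype.ext (AffineMap.lineMap_injective ℝ h hst)

theorem isSimpleCurve_segment {p q : Plane} (h : p ≠ q) : IsSimpleCurve (segment ℝ p q) p q :=
  ⟨Path.segment p q, injective_path_segment h, Path.range_segment p q⟩

theorem IsOneBendCurve.isSimpleCurve {A : Set Plane} {p q : Plane} (h : IsOneBendCurve A p q) :
    IsSimpleCurve A p q := by
  obtain ⟨b, hb, rfl⟩ := h
  have hpb : p ≠ b := by
    rintro rfl
    exact hb (by simpa using collinear_pair ℝ p q)
  have hbq : b ≠ q := by
    rintro rfl
    exact hb (by simpa using collinear_pair ℝ p b)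
  refine ⟨(Path.segment p b).trans (Path.segment b q), injective_path_trans
    (injective_path_segment hpb) (injective_path_segment hbq) ?_, ?_⟩
  · rw [Path.range_segment, Path.range_segment]
    rintro z ⟨hz₁, hz₂⟩
    by_contra hzb
    have hzb' : z ≠ b := hzb
    have c₁ := (mem_segment_iff_wbtw.1 hz₁).collinear
    have c₂ := (mem_segment_iff_wbtw.1 hz₂).collinear
    have hp : p ∈ line[ℝ, z, b] := c₁.mem_affineSpan_of_mem_of_ne (by simp) (by simp) (by simp) hzb'
    have hq : q ∈ line[ℝ, z, b] := c₂.mem_affineSpan_of_mem_of_ne (by simp) (by simp) (by simp) hzb'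
    refine hb ((collinear_insert_insert_of_mem_affineSpan_pair hp hq).subset ?_)
    intro x hx
    simp only [Set.mem_insert_iff, Set.mem_singleton_iff] at hx ⊢
    tauto
  · rw [Path.trans_range, Path.range_segment, Path.range_segment]

theorem IsOneBendCurve.symm {A : Set Plane} {p q : Plane} (h : IsOneBendCurve A p q) :
    IsOneBendCurve A q p := by
  obtain ⟨b, hb, rfl⟩ := h
  refine ⟨b, fun h => hb (h.subset ?_), ?_⟩
  · intro x hx
    simp only [Set.mem_insert_iff, Set.mem_singleton_iff] at hx ⊢
    tauto
  · rw [segment_symm ℝ q b, segment_symm ℝ b p, Set.union_comm]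

theorem swap_mem_segment_iff {p q z : Plane} :
    z.swap ∈ segment ℝ p q ↔ z ∈ segment ℝ p.swap q.swap := by
  have h : ∀ p q z : Plane, z ∈ segment ℝ p q → z.swap ∈ segment ℝ p.swap q.swap := by
    rintro p q z ⟨s, t, hs, ht, hst, rfl⟩
    exact ⟨s, t, hs, ht, hst, by ext <;> simp⟩
  exact ⟨fun hz => by simpa using h _ _ _ hz, fun hz => by simpa using h _ _ _ hz⟩

theorem IsOneBendCurve.swap {A : Set Plane} {p q : Plane} (h : IsOneBendCurve A p q) :
    IsOneBendCurve (Prod.swap ⁻¹' A) p.swap q.swap := by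
  obtain ⟨b, hb, rfl⟩ := h
  refine ⟨b.swap, fun h => hb ?_, ?_⟩
  · obtain ⟨o, v, hv⟩ := (collinear_iff_exists_forall_eq_smul_vadd (k := ℝ) _).1 h
    refine (collinear_iff_exists_forall_eq_smul_vadd (k := ℝ) _).2 ⟨o.swap, v.swap, fun x hx => ?_⟩
    obtain ⟨r, hr⟩ := hv x.swap (by
      simp only [Set.mem_insert_iff, Set.mem_singleton_iff] at hx ⊢
      rcases hx with rfl | rfl | rfl <;> simp)
    exact ⟨r, by rw [← Prod.swap_swap x, hr]; rfl⟩
  · ext z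
    simp only [Set.mem_preimage, Set.mem_union, swap_mem_segment_iff]

theorem cross_eq_zero_of_collinear {p b q : Plane} (h : Collinear ℝ {p, b, q}) :
    (p.1 - b.1) * (q.2 - b.2) = (p.2 - b.2) * (q.1 - b.1) := by
  obtain ⟨v, hv⟩ := (collinear_iff_of_mem (p₀ := b) (by simp)).1 h
  obtain ⟨s, hs⟩ := hv p (by simp)
  obtain ⟨t, ht⟩ := hv q (by simp)
  rw [hs, ht]
  simp
  ring

end Curves

/-! ### Tents -/

section Tents

/-- The apex of the tent over the points `p` and `q` (`p` to the left of `q`) whose sides have the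
slopes `σ` and `-σ`. -/
noncomputable def apex (σ : ℝ) (p q : Plane) : Plane :=
  ((p.1 + q.1) / 2 + (q.2 - p.2) / (2 * σ), (p.2 + q.2) / 2 + σ * (q.1 - p.1) / 2)

/-- The tent over the points `p` and `q` whose sides have the slopes `σ` and `-σ`. -/
noncomputable def tent (σ : ℝ) (p q : Plane) : Set Plane :=
  segment ℝ p (apex σ p q) ∪ segment ℝ (apex σ p q) q

variable {σ : ℝ} {p q z : Plane}

theorem apex_spec (hσ : 0 < σ) (h : |q.2 - p.2| < σ * (q.1 - p.1)) :
    p.1 < (apex σ p q).1 ∧ (apex σ p q).1 < q.1 ∧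
      (apex σ p q).2 = p.2 + σ * ((apex σ p q).1 - p.1) ∧
      (apex σ p q).2 = q.2 + σ * (q.1 - (apex σ p q).1) := by
  obtain ⟨d, hd⟩ : ∃ d, d = (q.2 - p.2) / (2 * σ) := ⟨_, rfl⟩
  have hd' : q.2 - p.2 = 2 * σ * d := by rw [hd]; field_simp
  rw [hd', abs_lt] at h
  have h₁ : 2 * d < q.1 - p.1 := by
    have := h.2
    nlinarith
  have h₂ : -(q.1 - p.1) < 2 * d := by
    have := h.1
    nlinarith
  simp only [apex, ← hd]
  refine ⟨by linarith, by linarith, by linarith, by linarith⟩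

theorem mem_left_side (hσ : 0 < σ) (h : |q.2 - p.2| < σ * (q.1 - p.1))
    (hz : z ∈ segment ℝ p (apex σ p q)) :
    p.1 ≤ z.1 ∧ z.1 < q.1 ∧ z.2 = p.2 + σ * (z.1 - p.1) ∧ z.2 ≤ q.2 + σ * (q.1 - z.1) := by
  obtain ⟨h₁, h₂, h₃, h₄⟩ := apex_spec hσ h
  obtain ⟨s, t, hs, ht, hst, rfl⟩ := hz
  obtain rfl : s = 1 - t := by linarith
  set b := apex σ p q
  simp only [Prod.fst_add, Prod.snd_add, Prod.smul_fst, Prod.smul_snd, smul_eq_mul]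
  have e : (1 - t) * p.1 + t * b.1 = b.1 - (1 - t) * (b.1 - p.1) := by ring
  have m := mul_nonneg hs (sub_pos.2 h₁).le
  refine ⟨by nlinarith, by linarith, by rw [h₃]; ring, ?_⟩
  have : (1 - t) * p.2 + t * b.2 = b.2 - σ * ((1 - t) * (b.1 - p.1)) := by rw [h₃]; ring
  rw [this, e]
  nlinarith [mul_nonneg hσ.le m]

theorem mem_right_side (hσ : 0 < σ) (h : |q.2 - p.2| < σ * (q.1 - p.1))
    (hz : z ∈ segment ℝ (apex σ p q) q) :
    p.1 < z.1 ∧ z.1 ≤ q.1 ∧ z.2 = q.2 + σ * (q.1 - z.1) ∧ z.2 ≤ p.2 + σ * (z.1 - p.1) := by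
  obtain ⟨h₁, h₂, h₃, h₄⟩ := apex_spec hσ h
  obtain ⟨s, t, hs, ht, hst, rfl⟩ := hz
  obtain rfl : s = 1 - t := by linarith
  set b := apex σ p q
  simp only [Prod.fst_add, Prod.snd_add, Prod.smul_fst, Prod.smul_snd, smul_eq_mul]
  have e : (1 - t) * b.1 + t * q.1 = b.1 + t * (q.1 - b.1) := by ring
  have m := mul_nonneg ht (sub_pos.2 h₂).le
  refine ⟨by linarith, by nlinarith, by rw [h₄]; ring, ?_⟩
  have : (1 - t) * b.2 + t * q.2 = b.2 - σ * (t * (q.1 - b.1)) := by rw [h₄]; ring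
  rw [this, e]
  nlinarith [mul_nonneg hσ.le m]

theorem mem_tent (hσ : 0 < σ) (h : |q.2 - p.2| < σ * (q.1 - p.1)) (hz : z ∈ tent σ p q) :
    p.1 ≤ z.1 ∧ z.1 ≤ q.1 ∧ z.2 ≤ p.2 + σ * (z.1 - p.1) ∧ z.2 ≤ q.2 + σ * (q.1 - z.1) ∧
      (z.1 < q.1 ∧ z.2 = p.2 + σ * (z.1 - p.1) ∨ p.1 < z.1 ∧ z.2 = q.2 + σ * (q.1 - z.1)) := by
  rcases hz with hz | hz
  · obtain ⟨h₁, h₂, h₃, h₄⟩ := mem_left_side hσ h hz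
    exact ⟨h₁, h₂.le, h₃.le, h₄, Or.inl ⟨h₂, h₃⟩⟩
  · obtain ⟨h₁, h₂, h₃, h₄⟩ := mem_right_side hσ h hz
    exact ⟨h₁.le, h₂, h₄, h₃.le, Or.inr ⟨h₁, h₃⟩⟩

theorem isOneBendCurve_tent (hσ : 0 < σ) (h : |q.2 - p.2| < σ * (q.1 - p.1)) :
    IsOneBendCurve (tent σ p q) p q := by
  refine ⟨apex σ p q, fun hc => ?_, rfl⟩
  obtain ⟨h₁, h₂, h₃, h₄⟩ := apex_spec hσ h
  have := cross_eq_zero_of_collinear hc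
  set b := apex σ p q
  have e₁ : q.2 - b.2 = -σ * (q.1 - b.1) := by linarith
  have e₂ : p.2 - b.2 = σ * (p.1 - b.1) := by linarith
  rw [e₁, e₂] at this
  nlinarith [mul_pos hσ (mul_pos (sub_pos.2 h₁) (sub_pos.2 h₂))]

/-- If a tent lies within the horizontal range of a steeper tent, then the two tents meet at most
in a common end. -/
theorem eq_of_mem_nested_tents {σ' : ℝ} {p' q' : Plane} (hσ : 0 < σ)
    (h : |q.2 - p.2| < σ * (q.1 - p.1)) (h' : |q'.2 - p'.2| < σ' * (q'.1 - p'.1)) (hlt : σ < σ')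
    (hp : p' = p ∨ p.2 < p'.2 + σ' * (p.1 - p'.1) ∧ p'.1 < p.1)
    (hq : q' = q ∨ q.2 < q'.2 + σ' * (q'.1 - q.1) ∧ q.1 < q'.1)
    (hz : z ∈ tent σ p q) (hz' : z ∈ tent σ' p' q') : (p' = p ∧ z = p) ∨ (q' = q ∧ z = q) := by
  obtain ⟨h₁, h₂, h₃, h₄, -⟩ := mem_tent hσ h hz
  obtain ⟨-, -, -, -, ⟨-, h₅⟩ | ⟨-, h₅⟩⟩ := mem_tent (hσ.trans hlt) h' hz'
  · left
    rcases hp with rfl | hp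
    · refine ⟨rfl, ?_⟩
      have : z.1 = p'.1 := by nlinarith
      exact Prod.ext this (by rw [h₅, this]; ring)
    · nlinarith [mul_nonneg (sub_pos.2 hlt).le (sub_nonneg.2 h₁)]
  · right
    rcases hq with rfl | hq
    · refine ⟨rfl, ?_⟩
      have : z.1 = q'.1 := by nlinarith
      exact Prod.ext this (by rw [h₅, this]; ring)
    · nlinarith [mul_nonneg (sub_pos.2 hlt).le (sub_nonneg.2 h₂)]

theorem encard_steep_inter_flat {A B : Set Plane} {σ τ : ℝ} (hσ : 1 < σ) (hτ : 1 < τ)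
    (hA : ∀ x ∈ A, ∀ y ∈ A, |x.2 - y.2| = σ * |x.1 - y.1|)
    (hB : ∀ x ∈ B, ∀ y ∈ B, |x.1 - y.1| = τ * |x.2 - y.2|) : (A ∩ B).encard ≤ 1 := by
  rw [Set.encard_le_one_iff]
  intro x y hx hy
  have h₁ := hA x hx.1 y hy.1
  have h₂ := hB x hx.2 y hy.2
  have n₁ := abs_nonneg (x.1 - y.1)
  have n₂ := abs_nonneg (x.2 - y.2)
  have z₁ : |x.1 - y.1| = 0 := by nlinarith
  have z₂ : |x.2 - y.2| = 0 := by rw [h₁, z₁, mul_zero]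
  exact Prod.ext (by linarith [abs_eq_zero.1 z₁]) (by linarith [abs_eq_zero.1 z₂])

theorem steep_left_side (hσ : 0 < σ) (h : |q.2 - p.2| < σ * (q.1 - p.1)) :
    ∀ x ∈ segment ℝ p (apex σ p q), ∀ y ∈ segment ℝ p (apex σ p q),
      |x.2 - y.2| = σ * |x.1 - y.1| := by
  intro x hx y hy
  rw [(mem_left_side hσ h hx).2.2.1, (mem_left_side hσ h hy).2.2.1, ← abs_of_pos hσ, ← abs_mul,
    abs_of_pos hσ]
  congr 1; ring

theorem steep_right_side (hσ : 0 < σ) (h : |q.2 - p.2| < σ * (q.1 - p.1)) :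
    ∀ x ∈ segment ℝ (apex σ p q) q, ∀ y ∈ segment ℝ (apex σ p q) q,
      |x.2 - y.2| = σ * |x.1 - y.1| := by
  intro x hx y hy
  rw [(mem_right_side hσ h hx).2.2.1, (mem_right_side hσ h hy).2.2.1, abs_sub_comm x.1,
    ← abs_of_pos hσ, ← abs_mul, abs_of_pos hσ]
  congr 1; ring

/-- A steep tent and a flat one have at most one common point for each pair of sides. -/
theorem encard_tent_inter_swap_tent {τ : ℝ} {p' q' : Plane} (hσ : 1 < σ) (hτ : 1 < τ)
    (h : |q.2 - p.2| < σ * (q.1 - p.1)) (h' : |q'.2 - p'.2| < τ * (q'.1 - p'.1)) :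
    (tent σ p q ∩ Prod.swap ⁻¹' tent τ p' q').encard ≤ 4 := by
  have l₁ := steep_left_side (by linarith) h
  have r₁ := steep_right_side (by linarith) h
  have l₂ := steep_left_side (by linarith) h'
  have r₂ := steep_right_side (by linarith) h'
  have k : ∀ A B : Set Plane, (∀ x ∈ A, ∀ y ∈ A, |x.2 - y.2| = σ * |x.1 - y.1|) →
      (∀ x ∈ B, ∀ y ∈ B, |x.2 - y.2| = τ * |x.1 - y.1|) →
      (A ∩ Prod.swap ⁻¹' B).encard ≤ 1 := fun A B hA hB =>
    encard_steep_inter_flat hσ hτ hA fun x hx y hy => hB _ hx _ hy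
  unfold tent
  rw [Set.preimage_union, Set.union_inter_distrib_right, Set.inter_union_distrib_left,
    Set.inter_union_distrib_left]
  refine (Set.encard_union_le _ _).trans ?_
  refine (add_le_add (Set.encard_union_le _ _) (Set.encard_union_le _ _)).trans ?_
  refine (add_le_add (add_le_add (k _ _ l₁ l₂) (k _ _ l₁ r₂))
    (add_le_add (k _ _ r₁ l₂) (k _ _ r₁ r₂))).trans ?_
  norm_num

end Tents

/-! ### Chords and tents in good position -/

section Drawing

variable {V : Type*}

/-- The straight-line drawing of the edge `e`. -/
def chord (X Y : V → ℝ) (e : Sym2 V) : Set Plane :=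
  {z | ∃ u v, e = s(u, v) ∧ z ∈ segment ℝ (X u, Y u) (X v, Y v)}

/-- The drawing of the edge `e` as a tent over the `x`-axis. The slope of its sides grows with the
width, so that nested tents do not meet. -/
def edgeTent (X Y : V → ℝ) (L : ℝ) (e : Sym2 V) : Set Plane :=
  {z | ∃ u v, e = s(u, v) ∧ X u < X v ∧ z ∈ tent (L + (X v - X u)) (X u, Y u) (X v, Y v)}

theorem chord_mk (X Y : V → ℝ) (u v : V) :
    chord X Y s(u, v) = segment ℝ (X u, Y u) (X v, Y v) := by
  ext z
  refine ⟨?_, fun h => ⟨u, v, rfl, h⟩⟩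
  rintro ⟨a, b, h, hz⟩
  rcases Sym2.eq_iff.1 h with ⟨rfl, rfl⟩ | ⟨rfl, rfl⟩
  · exact hz
  · rwa [segment_symm]

theorem edgeTent_mk {X Y : V → ℝ} {L : ℝ} {u v : V} (huv : X u < X v) :
    edgeTent X Y L s(u, v) = tent (L + (X v - X u)) (X u, Y u) (X v, Y v) := by
  ext z
  refine ⟨?_, fun h => ⟨u, v, rfl, huv, h⟩⟩
  rintro ⟨a, b, h, hab, hz⟩
  rcases Sym2.eq_iff.1 h with ⟨rfl, rfl⟩ | ⟨rfl, rfl⟩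
  · exact hz
  · exact absurd hab huv.not_gt

theorem swap_mem_chord_iff {X Y : V → ℝ} {e : Sym2 V} {z : Plane} :
    z.swap ∈ chord X Y e ↔ z ∈ chord Y X e := by
  induction e with | _ u v
  simp only [chord_mk, swap_mem_segment_iff, Prod.swap_prod_mk]

theorem fst_mem_Icc {p q z : Plane} (hz : z ∈ segment ℝ p q) (hpq : p.1 ≤ q.1) :
    p.1 ≤ z.1 ∧ z.1 ≤ q.1 := by
  obtain ⟨s, t, hs, ht, hst, rfl⟩ := hz
  obtain rfl : s = 1 - t := by linarith
  simp only [Prod.fst_add, Prod.smul_fst, smul_eq_mul]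
  constructor <;> nlinarith

theorem eq_of_fst_eq_right {p q z : Plane} (hz : z ∈ segment ℝ p q) (hpq : p.1 < q.1)
    (h : z.1 = q.1) : z = q := by
  obtain ⟨s, t, hs, ht, hst, rfl⟩ := hz
  obtain rfl : s = 1 - t := by linarith
  simp only [Prod.fst_add, Prod.smul_fst, smul_eq_mul] at h
  have : (1 - t) * (q.1 - p.1) = 0 := by linarith
  rw [(mul_eq_zero.1 this).resolve_right (by linarith)]
  obtain rfl : t = 1 := by linarith [(mul_eq_zero.1 this).resolve_right (by linarith)]
  simp

/-- Two arcs over a line that do not cross are disjoint, touching or nested. -/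
theorem noCross_cases {a b c d : ℝ} (h₁ : ¬ (a < c ∧ c < b ∧ b < d))
    (h₂ : ¬ (c < a ∧ a < d ∧ d < b)) :
    b < c ∨ d < a ∨ b = c ∨ d = a ∨ (a ≤ c ∧ d ≤ b) ∨ (c ≤ a ∧ b ≤ d) := by
  by_contra! h
  obtain ⟨e₁, e₂, e₃, e₄, e₅, e₆⟩ := h
  have e₁ := lt_of_le_of_ne e₁ e₃.symm
  have e₂ := lt_of_le_of_ne e₂ e₄.symm
  rcases lt_trichotomy a c with hac | rfl | hac
  · exact h₁ ⟨hac, e₁, e₅ hac.le⟩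
  · have := e₅ le_rfl
    have := e₆ le_rfl
    linarith
  · exact h₂ ⟨hac, e₂, e₆ hac.le⟩

variable {R B : (⊤ : SimpleGraph V).Subgraph} {X Y : V → ℝ} {L : ℝ}

namespace IsGoodPosition

theorem eq_of_X_eq (h : IsGoodPosition R B X Y) {u v : V} (hu : u ∈ R.verts ∪ B.verts)
    (hv : v ∈ R.verts ∪ B.verts) (huv : X u = X v) : u = v := by
  by_contra hne
  have := h.sepX u hu v hv hne
  rw [huv, sub_self, abs_zero] at this
  linarith

theorem one_le_sub (h : IsGoodPosition R B X Y) {u v : V} (hu : u ∈ R.verts ∪ B.verts)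
    (hv : v ∈ R.verts ∪ B.verts) (huv : X u < X v) : 1 ≤ X v - X u := by
  have := h.sepX v hv u hu (fun e => by rw [e] at huv; exact lt_irrefl _ huv)
  rwa [abs_of_pos (sub_pos.2 huv)] at this

/-- Every edge can be named from left to right. -/
theorem exists_mk (h : IsGoodPosition R B X Y) {G : (⊤ : SimpleGraph V).Subgraph} (hG : G = R ∨ G = B)
    {e : Sym2 V} (he : e ∈ G.edgeSet) :
    ∃ u v, e = s(u, v) ∧ G.Adj u v ∧ X u < X v ∧
      u ∈ R.verts ∪ B.verts ∧ v ∈ R.verts ∪ B.verts := by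
  induction e with | _ u v
  have hadj : G.Adj u v := he
  have hv : ∀ w, w ∈ G.verts → w ∈ R.verts ∪ B.verts := by
    rcases hG with rfl | rfl
    · exact fun _ => Or.inl
    · exact fun _ => Or.inr
  have hu := hv u hadj.fst_mem
  have hv := hv v hadj.snd_mem
  rcases lt_trichotomy (X u) (X v) with hlt | heq | hlt
  · exact ⟨u, v, rfl, hadj, hlt, hu, hv⟩
  · exact absurd (h.eq_of_X_eq hu hv heq) hadj.ne
  · exact ⟨v, u, Sym2.eq_swap, hadj.symm, hlt, hv, hu⟩

/-- The notion is symmetric in the two trees and the two coordinates. -/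
theorem swap (h : IsGoodPosition R B X Y) : IsGoodPosition B R Y X := by
  have desc : ∀ p q, R.Adj p q → B.Adj p q → Y p < Y q → X q < X p := by
    intro p q h₁ h₂ hlt
    rcases lt_trichotomy (X p) (X q) with hX | hX | hX
    · exact absurd (h.desc p q h₁ h₂ hX) hlt.not_gt
    · exact absurd (h.eq_of_X_eq (Or.inl h₁.fst_mem) (Or.inl h₁.snd_mem) hX) h₁.ne
    · exact hX
  have between : ∀ p q, R.Adj p q → B.Adj p q → ∀ u ∈ R.verts ∪ B.verts, Y p < Y u → Y u < Y q →
      X q < X u ∧ X u < X p := by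
    intro p q h₁ h₂ u hu h₃ h₄
    rcases h.above q p h₁.symm h₂.symm (desc p q h₁ h₂ (h₃.trans h₄)) u hu with ⟨-, hc⟩ | hc
    · rcases hc with hc | hc <;> linarith
    · exact ⟨hc.1, hc.2.1⟩
  refine ⟨?_, ?_, fun p q h₂ h₁ => desc p q h₁ h₂, ?_, ?_, h.noCrossBlue, h.noCrossRed⟩
  · rw [Set.union_comm]; exact h.sepY
  · rw [Set.union_comm]; exact h.sepX
  · intro p q h₂ h₁ hpq u hu
    rw [Set.union_comm] at hu
    rcases h.above q p h₁.symm h₂.symm (desc p q h₁ h₂ hpq) u hu with ⟨c₁, c₂⟩ | ⟨c₁, c₂, c₃, c₄, c₅⟩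
    · exact Or.inl ⟨c₂, c₁⟩
    · exact Or.inr ⟨c₃, c₄, c₁, c₂, by nlinarith⟩
  · rintro a b c d h₂ h₁ h₄ h₃ ⟨hac, hcb, hbd⟩
    have k₁ := between a b h₁ h₂ c (Or.inl h₃.fst_mem) hac hcb
    have k₂ := between c d h₃ h₄ b (Or.inl h₁.snd_mem) hcb hbd
    exact h.noCrossCommon d c b a h₃.symm h₄.symm h₁.symm h₂.symm ⟨k₂.1, k₁.1, k₁.2⟩

theorem mem_of_mem_chord (h : IsGoodPosition R B X Y) {e : Sym2 V}
    (he : e ∈ commonEdges R B) {w : V} (hw : w ∈ R.verts ∪ B.verts)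
    (hz : (X w, Y w) ∈ chord X Y e) : w ∈ e := by
  obtain ⟨p, q, rfl, hR, hlt, hp, hq⟩ := h.exists_mk (Or.inl rfl) he.1
  have hB : B.Adj p q := he.2
  rw [chord_mk] at hz
  obtain ⟨s, t, hs, ht, hst, hz⟩ := hz
  obtain rfl : s = 1 - t := by linarith
  have hx : X w = X p + t * (X q - X p) := by
    have := congrArg Prod.fst hz
    simp at this
    linarith
  have hy : Y w = Y p + t * (Y q - Y p) := by
    have := congrArg Prod.snd hz
    simp at this
    linarith
  have h₁ : X p ≤ X w := by nlinarith
  have h₂ : X w ≤ X q := by nlinarith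
  rw [Sym2.mem_iff]
  rcases h.above p q hR hB hlt w hw with ⟨hc | hc, -⟩ | ⟨-, -, -, -, hc⟩
  · exact Or.inl (h.eq_of_X_eq hw hp (le_antisymm hc h₁))
  · exact Or.inr (h.eq_of_X_eq hw hq (le_antisymm h₂ hc))
  · rw [hx, hy] at hc
    nlinarith

/-- If the horizontal range of a common edge `pq` contains that of another one, then they do not
cross: the signed height above the line `pq` is affine, it vanishes on the edge `pq`, and it is
positive at the ends of the other edge, apart from a common end. -/
theorem chord_inter_chord_of_le (h : IsGoodPosition R B X Y) {p q a b : V}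
    (hR : R.Adj p q) (hB : B.Adj p q) (hR' : R.Adj a b) (hpq : X p < X q) (hab : X a < X b)
    (hpa : X p ≤ X a) (hbq : X b ≤ X q) (hne : s(p, q) ≠ s(a, b)) {z : Plane}
    (hz : z ∈ segment ℝ (X p, Y p) (X q, Y q)) (hz' : z ∈ segment ℝ (X a, Y a) (X b, Y b)) :
    ∃ v, v ∈ s(p, q) ∧ v ∈ s(a, b) ∧ z = (X v, Y v) := by
  have hp : p ∈ R.verts ∪ B.verts := Or.inl hR.fst_mem
  have hq : q ∈ R.verts ∪ B.verts := Or.inl hR.snd_mem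
  have ha : a ∈ R.verts ∪ B.verts := Or.inl hR'.fst_mem
  have hb : b ∈ R.verts ∪ B.verts := Or.inl hR'.snd_mem
  have key : ∀ u ∈ R.verts ∪ B.verts, X p ≤ X u → X u ≤ X q → u = p ∨ u = q ∨
      0 < (Y u - Y p) * (X q - X p) - (X u - X p) * (Y q - Y p) := by
    intro u hu h₁ h₂
    rcases h.above p q hR hB hpq u hu with ⟨hc | hc, -⟩ | ⟨-, -, -, -, hc⟩
    · exact Or.inl (h.eq_of_X_eq hu hp (le_antisymm hc h₁))
    · exact Or.inr (Or.inl (h.eq_of_X_eq hu hq (le_antisymm h₂ hc)))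
    · exact Or.inr (Or.inr (by linarith))
  obtain ⟨s, t, hs, ht, hst, rfl⟩ := hz'
  obtain ⟨s', t', hs', ht', hst', hz⟩ := hz
  obtain rfl : s = 1 - t := by linarith
  obtain rfl : s' = 1 - t' := by linarith
  have hx : (1 - t') * X p + t' * X q = (1 - t) * X a + t * X b := by
    simpa using congrArg Prod.fst hz
  have hy : (1 - t') * Y p + t' * Y q = (1 - t) * Y a + t * Y b := by
    simpa using congrArg Prod.snd hz
  -- `A` and `D` are the scaled heights of the ends of `ab` above the line `pq`
  obtain ⟨A, hA⟩ : ∃ A, A = (Y a - Y p) * (X q - X p) - (X a - X p) * (Y q - Y p) := ⟨_, rfl⟩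
  obtain ⟨D, hD⟩ : ∃ D, D = (Y b - Y p) * (X q - X p) - (X b - X p) * (Y q - Y p) := ⟨_, rfl⟩
  have hsum : (1 - t) * A + t * D = 0 := by
    rw [hA, hD]
    linear_combination (Y q - Y p) * hx - (X q - X p) * hy
  have kA : (a = p ∧ A = 0) ∨ 0 < A := by
    rcases key a ha hpa (hab.le.trans hbq) with rfl | rfl | hc
    · exact Or.inl ⟨rfl, by rw [hA]; ring⟩
    · linarith
    · exact Or.inr (hA ▸ hc)
  have kD : (b = q ∧ D = 0) ∨ 0 < D := by
    rcases key b hb (hpa.trans hab.le) hbq with rfl | rfl | hc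
    · linarith
    · exact Or.inl ⟨rfl, by rw [hD]; ring⟩
    · exact Or.inr (hD ▸ hc)
  rcases kA with ⟨rfl, hA0⟩ | hA0 <;> rcases kD with ⟨rfl, hD0⟩ | hD0
  · exact absurd rfl hne
  · obtain rfl : t = 0 := by
      rw [hA0, mul_zero, zero_add] at hsum
      exact (mul_eq_zero.1 hsum).resolve_right hD0.ne'
    exact ⟨a, by simp, by simp, by simp⟩
  · obtain rfl : t = 1 := by
      rw [hD0, mul_zero, add_zero] at hsum
      linarith [(mul_eq_zero.1 hsum).resolve_right hA0.ne']
    exact ⟨b, by simp, by simp, by simp⟩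
  · exfalso
    rcases ht.eq_or_lt with rfl | ht
    · linarith
    · nlinarith [mul_nonneg hs hA0.le, mul_pos ht hD0]

theorem chord_inter_chord (h : IsGoodPosition R B X Y) {e f : Sym2 V}
    (he : e ∈ commonEdges R B) (hf : f ∈ commonEdges R B) (hne : e ≠ f) {z : Plane}
    (hz : z ∈ chord X Y e) (hz' : z ∈ chord X Y f) : ∃ v, v ∈ e ∧ v ∈ f ∧ z = (X v, Y v) := by
  obtain ⟨a, b, rfl, hR, hab, ha, hb⟩ := h.exists_mk (Or.inl rfl) he.1
  obtain ⟨c, d, rfl, hR', hcd, hc, hd⟩ := h.exists_mk (Or.inl rfl) hf.1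
  have hB : B.Adj a b := he.2
  have hB' : B.Adj c d := hf.2
  rw [chord_mk] at hz hz'
  have i := fst_mem_Icc hz hab.le
  have i' := fst_mem_Icc hz' hcd.le
  simp only at i i'
  rcases noCross_cases (h.noCrossCommon a b c d hR hB hR' hB')
    (h.noCrossCommon c d a b hR' hB' hR hB) with k | k | k | k | k | k
  · linarith
  · linarith
  · obtain rfl := h.eq_of_X_eq hb hc k
    exact ⟨b, by simp, by simp, eq_of_fst_eq_right hz hab (le_antisymm i.2 i'.1)⟩
  · obtain rfl := h.eq_of_X_eq hd ha k
    exact ⟨d, by simp, by simp, eq_of_fst_eq_right hz' hcd (le_antisymm i'.2 i.1)⟩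
  · exact h.chord_inter_chord_of_le hR hB hR' hab hcd k.1 k.2 hne hz hz'
  · obtain ⟨v, h₁, h₂, h₃⟩ :=
      h.chord_inter_chord_of_le hR' hB' hR hcd hab k.1 k.2 hne.symm hz' hz
    exact ⟨v, h₂, h₁, h₃⟩

/-- Seen from any vertex `u`, the other vertices are outside the cone of the tents at `u`. -/
theorem lt_cone_of_vertex (h : IsGoodPosition R B X Y)
    (hL : ∀ u ∈ R.verts ∪ B.verts, ∀ v ∈ R.verts ∪ B.verts, |Y u - Y v| + 1 ≤ L) {u w : V}
    (hu : u ∈ R.verts ∪ B.verts) (hw : w ∈ R.verts ∪ B.verts) (hne : w ≠ u) :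
    Y w < Y u + L * |X w - X u| := by
  have h₁ := h.sepX w hw u hu hne
  have h₂ := hL w hw u hu
  have h₃ := le_abs_self (Y w - Y u)
  have h₄ := abs_nonneg (Y w - Y u)
  nlinarith

/-- Seen from any vertex `u`, the common edges are outside the cone of the tents at `u`. -/
theorem lt_cone_of_mem_chord (h : IsGoodPosition R B X Y)
    (hL : ∀ u ∈ R.verts ∪ B.verts, ∀ v ∈ R.verts ∪ B.verts, |Y u - Y v| + 1 ≤ L) {u : V}
    (hu : u ∈ R.verts ∪ B.verts) {e : Sym2 V} (he : e ∈ commonEdges R B) {z : Plane}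
    (hz : z ∈ chord X Y e) : z = (X u, Y u) ∨ z.2 < Y u + L * |z.1 - X u| := by
  obtain ⟨p, q, rfl, hR, hpq, hp, hq⟩ := h.exists_mk (Or.inl rfl) he.1
  have hB : B.Adj p q := he.2
  rw [chord_mk] at hz
  obtain ⟨s, t, hs, ht, hst, rfl⟩ := hz
  obtain rfl : s = 1 - t := by linarith
  simp only [Prod.smul_mk, smul_eq_mul, Prod.mk_add_mk, Prod.mk.injEq]
  by_cases hb : X p < X u ∧ X u < X q
  · -- `u` is above the chord, whose slope is at most `L` in absolute value
    right
    have hc : (X u - X p) * (Y q - Y p) < (Y u - Y p) * (X q - X p) := by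
      rcases h.above p q hR hB hpq u hu with ⟨hc | hc, -⟩ | ⟨-, -, -, -, hc⟩
      · linarith
      · linarith
      · exact hc
    have h₁ := h.one_le_sub hp hq hpq
    have h₂ := hL q hq p hp
    set x := (1 - t) * X p + t * X q with hx
    have h₃ : (Y q - Y p) * (x - X u) ≤ (X q - X p) * (L * |x - X u|) := by
      have m₁ : (Y q - Y p) * (x - X u) ≤ |Y q - Y p| * |x - X u| := by
        rw [← abs_mul]; exact le_abs_self _
      have m₂ : |Y q - Y p| * |x - X u| ≤ L * |x - X u| :=
        mul_le_mul_of_nonneg_right (by linarith) (abs_nonneg _)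
      have m₃ : 0 ≤ L * |x - X u| :=
        mul_nonneg (by linarith [abs_nonneg (Y q - Y p)]) (abs_nonneg _)
      nlinarith
    have h₄ : (X q - X p) * ((1 - t) * Y p + t * Y q - Y u) <
        (X q - X p) * (L * |x - X u|) := by
      refine lt_of_lt_of_le ?_ h₃
      rw [hx]
      nlinarith
    have := lt_of_mul_lt_mul_left h₄ (by linarith)
    linarith
  · -- the cone is bounded by a line over the range of the chord
    have hsg : ∃ σ : ℝ, (∀ x, σ * x ≤ |x|) ∧ σ * (X p - X u) = |X p - X u| ∧
        σ * (X q - X u) = |X q - X u| := by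
      rcases not_and_or.1 hb with hb | hb
      · refine ⟨1, fun x => by rw [one_mul]; exact le_abs_self x, ?_, ?_⟩
        · rw [one_mul, abs_of_nonneg (by linarith)]
        · rw [one_mul, abs_of_nonneg (by linarith)]
      · refine ⟨-1, fun x => by rw [neg_one_mul]; exact neg_le_abs x, ?_, ?_⟩
        · rw [neg_one_mul, abs_of_nonpos (by linarith)]
        · rw [neg_one_mul, abs_of_nonpos (by linarith)]
    obtain ⟨σ, hσ, hσp, hσq⟩ := hsg
    have hL0 : 0 ≤ L := by linarith [hL u hu u hu, abs_nonneg (Y u - Y u)]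
    have hx := mul_le_mul_of_nonneg_left (hσ ((1 - t) * X p + t * X q - X u)) hL0
    have e₁ : L * (σ * ((1 - t) * X p + t * X q - X u)) =
        (1 - t) * (L * |X p - X u|) + t * (L * |X q - X u|) := by
      rw [← hσp, ← hσq]; ring
    rw [e₁] at hx
    have kp : p = u ∨ Y p < Y u + L * |X p - X u| := by
      by_cases hpu : p = u
      · exact Or.inl hpu
      · exact Or.inr (h.lt_cone_of_vertex hL hu hp hpu)
    have kq : q = u ∨ Y q < Y u + L * |X q - X u| := by
      by_cases hqu : q = u
      · exact Or.inl hqu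
      · exact Or.inr (h.lt_cone_of_vertex hL hu hq hqu)
    rcases kp with rfl | kp <;> rcases kq with rfl | kq
    · exact absurd hpq (lt_irrefl _)
    · rcases ht.eq_or_lt with rfl | ht
      · left; simp
      · right
        rw [sub_self, abs_zero, mul_zero, mul_zero, zero_add] at hx
        nlinarith [mul_pos ht (sub_pos.2 kq)]
    · rcases hs.eq_or_lt with hs | hs
      · left
        obtain rfl : t = 1 := by linarith
        simp
      · right
        rw [sub_self, abs_zero, mul_zero, mul_zero, add_zero] at hx
        nlinarith [mul_pos hs (sub_pos.2 kp)]
    · right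
      rcases ht.eq_or_lt with rfl | ht
      · linarith
      · nlinarith [mul_nonneg hs (sub_pos.2 kp).le, mul_pos ht (sub_pos.2 kq)]

/-- The sides of a tent are steep enough for `apex_spec`. -/
theorem abs_lt_slope_mul (h : IsGoodPosition R B X Y)
    (hL : ∀ u ∈ R.verts ∪ B.verts, ∀ v ∈ R.verts ∪ B.verts, |Y u - Y v| + 1 ≤ L) {u v : V}
    (hu : u ∈ R.verts ∪ B.verts) (hv : v ∈ R.verts ∪ B.verts) (huv : X u < X v) :
    1 < L + (X v - X u) ∧ |Y v - Y u| < (L + (X v - X u)) * (X v - X u) := by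
  have h₁ := h.one_le_sub hu hv huv
  have h₂ := hL v hv u hu
  have h₃ := abs_nonneg (Y v - Y u)
  exact ⟨by linarith, by nlinarith⟩

/-- A tent runs in the cones of its ends. -/
theorem cone_le_of_mem_edgeTent (h : IsGoodPosition R B X Y)
    (hL : ∀ u ∈ R.verts ∪ B.verts, ∀ v ∈ R.verts ∪ B.verts, |Y u - Y v| + 1 ≤ L)
    {G : (⊤ : SimpleGraph V).Subgraph} (hG : G = R ∨ G = B) {e : Sym2 V} (he : e ∈ G.edgeSet)
    {z : Plane} (hz : z ∈ edgeTent X Y L e) :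
    ∃ u ∈ R.verts ∪ B.verts, u ∈ e ∧ Y u + L * |z.1 - X u| ≤ z.2 := by
  obtain ⟨u, v, rfl, -, huv, hu, hv⟩ := h.exists_mk hG he
  rw [edgeTent_mk huv] at hz
  obtain ⟨h₁, h₂⟩ := h.abs_lt_slope_mul hL hu hv huv
  obtain ⟨k₁, k₂, -, -, ⟨-, k⟩ | ⟨-, k⟩⟩ := mem_tent (by linarith) h₂ hz
  · refine ⟨u, hu, by simp, ?_⟩
    simp only at k₁ k
    rw [abs_of_nonneg (by linarith), k]
    nlinarith
  · refine ⟨v, hv, by simp, ?_⟩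
    simp only at k₂ k
    rw [abs_of_nonpos (by linarith), k]
    nlinarith

theorem mem_of_mem_edgeTent (h : IsGoodPosition R B X Y)
    (hL : ∀ u ∈ R.verts ∪ B.verts, ∀ v ∈ R.verts ∪ B.verts, |Y u - Y v| + 1 ≤ L)
    {e : Sym2 V} (he : e ∈ R.edgeSet) {w : V} (hw : w ∈ R.verts ∪ B.verts)
    (hz : (X w, Y w) ∈ edgeTent X Y L e) : w ∈ e := by
  obtain ⟨u, hu, hue, hle⟩ := h.cone_le_of_mem_edgeTent hL (Or.inl rfl) he hz
  by_cases hwu : w = u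
  · exact hwu ▸ hue
  · exact absurd (h.lt_cone_of_vertex hL hu hw hwu) hle.not_gt

theorem edgeTent_inter_chord (h : IsGoodPosition R B X Y)
    (hL : ∀ u ∈ R.verts ∪ B.verts, ∀ v ∈ R.verts ∪ B.verts, |Y u - Y v| + 1 ≤ L)
    {e f : Sym2 V} (he : e ∈ R.edgeSet) (hf : f ∈ commonEdges R B) {z : Plane}
    (hz : z ∈ edgeTent X Y L e) (hz' : z ∈ chord X Y f) :
    ∃ v, v ∈ e ∧ v ∈ f ∧ z = (X v, Y v) := by
  obtain ⟨u, hu, hue, hle⟩ := h.cone_le_of_mem_edgeTent hL (Or.inl rfl) he hz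
  rcases h.lt_cone_of_mem_chord hL hu hf hz' with rfl | hlt
  · exact ⟨u, hue, h.mem_of_mem_chord hf hu hz', rfl⟩
  · exact absurd hlt hle.not_gt

theorem edgeTent_inter_edgeTent_of_le (h : IsGoodPosition R B X Y)
    (hL : ∀ u ∈ R.verts ∪ B.verts, ∀ v ∈ R.verts ∪ B.verts, |Y u - Y v| + 1 ≤ L)
    {a b c d : V} (ha : a ∈ R.verts ∪ B.verts) (hb : b ∈ R.verts ∪ B.verts)
    (hc : c ∈ R.verts ∪ B.verts) (hd : d ∈ R.verts ∪ B.verts) (hab : X a < X b) (hcd : X c < X d)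
    (hca : X c ≤ X a) (hbd : X b ≤ X d) (hne : s(a, b) ≠ s(c, d)) {z : Plane}
    (hz : z ∈ edgeTent X Y L s(a, b)) (hz' : z ∈ edgeTent X Y L s(c, d)) :
    ∃ v, v ∈ s(a, b) ∧ v ∈ s(c, d) ∧ z = (X v, Y v) := by
  rw [edgeTent_mk hab] at hz
  rw [edgeTent_mk hcd] at hz'
  obtain ⟨k₁, k₂⟩ := h.abs_lt_slope_mul hL ha hb hab
  obtain ⟨k₁', k₂'⟩ := h.abs_lt_slope_mul hL hc hd hcd
  have hlt : L + (X b - X a) < L + (X d - X c) := by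
    rcases hca.lt_or_eq with hca | hca
    · linarith
    rcases hbd.lt_or_eq with hbd | hbd
    · linarith
    · exact absurd (by rw [h.eq_of_X_eq hc ha hca, h.eq_of_X_eq hb hd hbd]) hne
  have hp : ((X c, Y c) : Plane) = (X a, Y a) ∨
      Y a < Y c + (L + (X d - X c)) * (X a - X c) ∧ X c < X a := by
    rcases hca.lt_or_eq with hca | hca
    · refine Or.inr ⟨?_, hca⟩
      have h₁ := h.one_le_sub hc ha hca
      have h₂ := hL a ha c hc
      have h₃ := le_abs_self (Y a - Y c)
      nlinarith
    · rw [h.eq_of_X_eq hc ha hca]; exact Or.inl rfl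
  have hq : ((X d, Y d) : Plane) = (X b, Y b) ∨
      Y b < Y d + (L + (X d - X c)) * (X d - X b) ∧ X b < X d := by
    rcases hbd.lt_or_eq with hbd | hbd
    · refine Or.inr ⟨?_, hbd⟩
      have h₁ := h.one_le_sub hb hd hbd
      have h₂ := hL b hb d hd
      have h₃ := le_abs_self (Y b - Y d)
      nlinarith
    · rw [h.eq_of_X_eq hb hd hbd]; exact Or.inl rfl
  rcases eq_of_mem_nested_tents (by linarith) k₂ k₂' hlt hp hq hz hz' with ⟨h₁, h₂⟩ | ⟨h₁, h₂⟩
  · have := h.eq_of_X_eq hc ha (congrArg Prod.fst h₁)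
    exact ⟨a, by simp, by simp [this], h₂⟩
  · have := h.eq_of_X_eq hd hb (congrArg Prod.fst h₁)
    exact ⟨b, by simp, by simp [this], h₂⟩

theorem edgeTent_inter_edgeTent (h : IsGoodPosition R B X Y)
    (hL : ∀ u ∈ R.verts ∪ B.verts, ∀ v ∈ R.verts ∪ B.verts, |Y u - Y v| + 1 ≤ L)
    {e f : Sym2 V} (he : e ∈ R.edgeSet \ B.edgeSet) (hf : f ∈ R.edgeSet \ B.edgeSet) (hne : e ≠ f)
    {z : Plane} (hz : z ∈ edgeTent X Y L e) (hz' : z ∈ edgeTent X Y L f) :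
    ∃ v, v ∈ e ∧ v ∈ f ∧ z = (X v, Y v) := by
  obtain ⟨a, b, rfl, hR, hab, ha, hb⟩ := h.exists_mk (Or.inl rfl) he.1
  obtain ⟨c, d, rfl, hR', hcd, hc, hd⟩ := h.exists_mk (Or.inl rfl) hf.1
  have hB : ¬ B.Adj a b := he.2
  have hB' : ¬ B.Adj c d := hf.2
  have hz₀ := hz
  have hz₀' := hz'
  rw [edgeTent_mk hab] at hz₀
  rw [edgeTent_mk hcd] at hz₀'
  obtain ⟨k₁, k₂⟩ := h.abs_lt_slope_mul hL ha hb hab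
  obtain ⟨k₁', k₂'⟩ := h.abs_lt_slope_mul hL hc hd hcd
  obtain ⟨i₁, i₂, -, -, i₃⟩ := mem_tent (by linarith) k₂ hz₀
  obtain ⟨j₁, j₂, -, -, j₃⟩ := mem_tent (by linarith) k₂' hz₀'
  simp only at i₁ i₂ i₃ j₁ j₂ j₃
  rcases noCross_cases (h.noCrossRed a b c d hR hB hR' hB')
    (h.noCrossRed c d a b hR' hB' hR hB) with k | k | k | k | k | k
  · linarith
  · linarith
  · obtain rfl := h.eq_of_X_eq hb hc k
    have hx : z.1 = X b := le_antisymm i₂ j₁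
    rcases i₃ with i₃ | i₃
    · linarith
    · exact ⟨b, by simp, by simp, Prod.ext hx (by rw [i₃.2, hx]; ring)⟩
  · obtain rfl := h.eq_of_X_eq hd ha k
    have hx : z.1 = X d := le_antisymm j₂ i₁
    rcases j₃ with j₃ | j₃
    · linarith
    · exact ⟨d, by simp, by simp, Prod.ext hx (by rw [j₃.2, hx]; ring)⟩
  · obtain ⟨v, h₁, h₂, h₃⟩ :=
      h.edgeTent_inter_edgeTent_of_le hL hc hd ha hb hcd hab k.1 k.2 hne.symm hz' hz
    exact ⟨v, h₂, h₁, h₃⟩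
  · exact h.edgeTent_inter_edgeTent_of_le hL ha hb hc hd hab hcd k.1 k.2 hne hz hz'

theorem isOneBendCurve_edgeTent (h : IsGoodPosition R B X Y)
    (hL : ∀ u ∈ R.verts ∪ B.verts, ∀ v ∈ R.verts ∪ B.verts, |Y u - Y v| + 1 ≤ L)
    {u v : V} (huv : R.Adj u v) :
    IsOneBendCurve (edgeTent X Y L s(u, v)) (X u, Y u) (X v, Y v) := by
  obtain ⟨a, b, hab, hR, hlt, ha, hb⟩ := h.exists_mk (Or.inl rfl) (e := s(u, v)) huv
  obtain ⟨k₁, k₂⟩ := h.abs_lt_slope_mul hL ha hb hlt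
  have := isOneBendCurve_tent (p := (X a, Y a)) (q := (X b, Y b)) (by linarith) k₂
  rw [← edgeTent_mk hlt] at this
  rcases Sym2.eq_iff.1 hab with ⟨rfl, rfl⟩ | ⟨rfl, rfl⟩
  · exact this
  · rw [hab]; exact this.symm

theorem encard_edgeTent_inter (h : IsGoodPosition R B X Y)
    (hL : ∀ u ∈ R.verts ∪ B.verts, ∀ v ∈ R.verts ∪ B.verts, |Y u - Y v| + 1 ≤ L)
    (hL' : ∀ u ∈ B.verts ∪ R.verts, ∀ v ∈ B.verts ∪ R.verts, |X u - X v| + 1 ≤ L)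
    {e f : Sym2 V} (he : e ∈ R.edgeSet) (hf : f ∈ B.edgeSet) :
    (edgeTent X Y L e ∩ Prod.swap ⁻¹' edgeTent Y X L f).encard ≤ 4 := by
  obtain ⟨a, b, rfl, -, hab, ha, hb⟩ := h.exists_mk (Or.inl rfl) he
  obtain ⟨c, d, rfl, -, hcd, hc, hd⟩ := h.swap.exists_mk (Or.inl rfl) hf
  obtain ⟨k₁, k₂⟩ := h.abs_lt_slope_mul hL ha hb hab
  obtain ⟨k₁', k₂'⟩ := h.swap.abs_lt_slope_mul hL' hc hd hcd
  rw [edgeTent_mk hab, edgeTent_mk hcd]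
  exact encard_tent_inter_swap_tent k₁ k₁' k₂ k₂'

end IsGoodPosition

end Drawing

/-! ### The simultaneous embedding -/

theorem exists_bound_abs_sub {V : Type*} {U : Set V} (hU : U.Finite) (Z : V → ℝ) :
    ∃ L, ∀ u ∈ U, ∀ v ∈ U, |Z u - Z v| + 1 ≤ L := by
  obtain ⟨L, hL⟩ := ((hU.prod hU).image fun w : V × V => |Z w.1 - Z w.2| + 1).bddAbove
  exact ⟨L, fun u hu v hv => hL ⟨(u, v), ⟨hu, hv⟩, rfl⟩⟩

/-- In good position, with the common edges drawn as chords, the drawing of one of the two trees is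
plane as soon as its exclusive edges avoid the vertices, the chords and each other. -/
theorem isPlaneDrawing_of_chord {V : Type*} {R B G : (⊤ : SimpleGraph V).Subgraph} {X Y : V → ℝ}
    {Γ : Placement V} (h : IsGoodPosition R B X Y) (hG : G = R ∨ G = B)
    (hpt : ∀ v, Γ.point v = (X v, Y v))
    (hcom : ∀ e ∈ commonEdges R B, Γ.curve e = chord X Y e)
    (hbend : ∀ u v, G.Adj u v → s(u, v) ∉ commonEdges R B →
      IsOneBendCurve (Γ.curve s(u, v)) (Γ.point u) (Γ.point v))
    (havoid : ∀ e ∈ G.edgeSet, e ∉ commonEdges R B → ∀ w ∈ R.verts ∪ B.verts,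
      Γ.point w ∈ Γ.curve e → w ∈ e)
    (hexcom : ∀ e ∈ G.edgeSet, e ∉ commonEdges R B → ∀ f ∈ commonEdges R B,
      ∀ x ∈ Γ.curve e ∩ Γ.curve f, ∃ v, v ∈ e ∧ v ∈ f ∧ x = Γ.point v)
    (hexex : ∀ e ∈ G.edgeSet, e ∉ commonEdges R B → ∀ f ∈ G.edgeSet, f ∉ commonEdges R B → e ≠ f →
      ∀ x ∈ Γ.curve e ∩ Γ.curve f, ∃ v, v ∈ e ∧ v ∈ f ∧ x = Γ.point v) :
    Γ.IsPlaneDrawing G ∧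
      ∀ e ∈ G.edgeSet, ∀ w ∈ R.verts ∪ B.verts, Γ.point w ∈ Γ.curve e → w ∈ e := by
  have hsub : ∀ w ∈ G.verts, w ∈ R.verts ∪ B.verts := by
    rcases hG with rfl | rfl
    · exact fun _ => Or.inl
    · exact fun _ => Or.inr
  have inj : ∀ u ∈ R.verts ∪ B.verts, ∀ v ∈ R.verts ∪ B.verts, Γ.point u = Γ.point v → u = v := by
    intro u hu v hv huv
    rw [hpt, hpt] at huv
    exact h.eq_of_X_eq hu hv (congrArg Prod.fst huv)
  have avoid : ∀ e ∈ G.edgeSet, ∀ w ∈ R.verts ∪ B.verts, Γ.point w ∈ Γ.curve e → w ∈ e := by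
    intro e he w hw hwe
    by_cases hc : e ∈ commonEdges R B
    · rw [hcom e hc, hpt] at hwe
      exact h.mem_of_mem_chord hc hw hwe
    · exact havoid e he hc w hw hwe
  refine ⟨⟨⟨fun u hu v hv => inj u (hsub u hu) v (hsub v hv), fun u v huv => ?_,
    fun e he w hw => avoid e he w (hsub w hw)⟩, fun e he f hf hef x hx => ?_⟩, avoid⟩
  · by_cases hc : s(u, v) ∈ commonEdges R B
    · rw [hcom _ hc, chord_mk, ← hpt, ← hpt]
      exact isSimpleCurve_segment fun e =>
        huv.ne (inj u (hsub u huv.fst_mem) v (hsub v huv.snd_mem) e)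
    · exact (hbend u v huv hc).isSimpleCurve
  · by_cases hc : e ∈ commonEdges R B <;> by_cases hc' : f ∈ commonEdges R B
    · rw [hcom e hc, hcom f hc'] at hx
      simpa only [hpt] using h.chord_inter_chord hc hc' hef hx.1 hx.2
    · obtain ⟨v, h₁, h₂, h₃⟩ := hexcom f hf hc' e hc x hx.symm
      exact ⟨v, h₂, h₁, h₃⟩
    · exact hexcom e he hc f hc' x hx
    · exact hexex e he hc f hf hc' hef x hx

theorem encard_le_one_of_noCross {V : Type*} {e f : Sym2 V} (hef : e ≠ f) {A : Set Plane}
    {P : V → Plane} (h : ∀ x ∈ A, ∃ v, v ∈ e ∧ v ∈ f ∧ x = P v) : A.encard ≤ 1 := by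
  rw [Set.encard_le_one_iff]
  intro x y hx hy
  obtain ⟨v, hve, hvf, rfl⟩ := h x hx
  obtain ⟨w, hwe, hwf, rfl⟩ := h y hy
  by_cases hvw : v = w
  · rw [hvw]
  · exact absurd (((Sym2.mem_and_mem_iff hvw).1 ⟨hve, hwe⟩).trans
      ((Sym2.mem_and_mem_iff hvw).1 ⟨hvf, hwf⟩).symm) hef

theorem theorem1 {V : Type*} (R B : (⊤ : SimpleGraph V).Subgraph)
    (hRfin : R.verts.Finite) (hBfin : B.verts.Finite)
    (hR : R.coe.IsTree) (hB : B.coe.IsTree) :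
    ∃ Γ : Placement V, Γ.IsSefe R B ∧
      (∀ u v : V, s(u, v) ∈ exclusiveEdges R B →
        IsOneBendCurve (Γ.curve s(u, v)) (Γ.point u) (Γ.point v)) ∧
      (∀ u v : V, s(u, v) ∈ commonEdges R B →
        Γ.curve s(u, v) = segment ℝ (Γ.point u) (Γ.point v)) ∧
      (∀ e ∈ exclusiveEdges R B, ∀ f ∈ exclusiveEdges R B, e ≠ f →
        (Γ.curve e ∩ Γ.curve f).encard ≤ 4) := by
  classical
  obtain ⟨X, Y, h⟩ := exists_isGoodPosition R B hRfin hBfin hR hB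
  obtain ⟨LX, hLX⟩ := exists_bound_abs_sub (hRfin.union hBfin) X
  obtain ⟨LY, hLY⟩ := exists_bound_abs_sub (hRfin.union hBfin) Y
  set L := max LX LY
  have hL : ∀ u ∈ R.verts ∪ B.verts, ∀ v ∈ R.verts ∪ B.verts, |Y u - Y v| + 1 ≤ L :=
    fun u hu v hv => (hLY u hu v hv).trans (le_max_right _ _)
  have hL' : ∀ u ∈ B.verts ∪ R.verts, ∀ v ∈ B.verts ∪ R.verts, |X u - X v| + 1 ≤ L := by
    rw [Set.union_comm]
    exact fun u hu v hv => (hLX u hu v hv).trans (le_max_left _ _)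
  have h' := h.swap
  have hcomm : ∀ e, e ∈ commonEdges R B ↔ e ∈ commonEdges B R := fun e => and_comm
  set Γ : Placement V := ⟨fun v => (X v, Y v), fun e => if e ∈ commonEdges R B then chord X Y e
    else if e ∈ R.edgeSet then edgeTent X Y L e else Prod.swap ⁻¹' edgeTent Y X L e⟩ with hΓ
  have hcom : ∀ e ∈ commonEdges R B, Γ.curve e = chord X Y e := fun e he => by simp [hΓ, he]
  have hred : ∀ e ∈ R.edgeSet, e ∉ commonEdges R B → Γ.curve e = edgeTent X Y L e :=
    fun e he he' => by simp [hΓ, he, he']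
  have hblue : ∀ e ∈ B.edgeSet, e ∉ commonEdges R B →
      Γ.curve e = Prod.swap ⁻¹' edgeTent Y X L e := fun e he he' => by
    have : e ∉ R.edgeSet := fun hr => he' ⟨hr, he⟩
    simp [hΓ, this, he']
  have bendR : ∀ u v, R.Adj u v → s(u, v) ∉ commonEdges R B →
      IsOneBendCurve (Γ.curve s(u, v)) (Γ.point u) (Γ.point v) := fun u v huv hc => by
    rw [hred _ huv hc]
    exact h.isOneBendCurve_edgeTent hL huv
  have bendB : ∀ u v, B.Adj u v → s(u, v) ∉ commonEdges R B →
      IsOneBendCurve (Γ.curve s(u, v)) (Γ.point u) (Γ.point v) := fun u v huv hc => by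
    rw [hblue _ huv hc]
    exact (h'.isOneBendCurve_edgeTent hL' huv).swap
  obtain ⟨planeR, avoidR⟩ := isPlaneDrawing_of_chord (G := R) (Γ := Γ) h (Or.inl rfl)
    (fun _ => rfl) hcom bendR
    (fun e he hc w hw hwe => by
      rw [hred e he hc] at hwe
      exact h.mem_of_mem_edgeTent hL he hw hwe)
    (fun e he hc f hf x hx => by
      rw [hred e he hc, hcom f hf] at hx
      exact h.edgeTent_inter_chord hL he hf hx.1 hx.2)
    (fun e he hc f hf hc' hef x hx => by
      rw [hred e he hc, hred f hf hc'] at hx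
      exact h.edgeTent_inter_edgeTent hL ⟨he, fun hb => hc ⟨he, hb⟩⟩ ⟨hf, fun hb => hc' ⟨hf, hb⟩⟩
        hef hx.1 hx.2)
  obtain ⟨planeB, avoidB⟩ := isPlaneDrawing_of_chord (G := B) (Γ := Γ) h (Or.inr rfl)
    (fun _ => rfl) hcom bendB
    (fun e he hc w hw hwe => by
      rw [hblue e he hc] at hwe
      exact h'.mem_of_mem_edgeTent hL' he (hw.symm) hwe)
    (fun e he hc f hf x hx => by
      rw [hblue e he hc, hcom f hf] at hx
      obtain ⟨v, h₁, h₂, h₃⟩ := h'.edgeTent_inter_chord hL' he ((hcomm f).1 hf) hx.1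
        (swap_mem_chord_iff.2 hx.2)
      exact ⟨v, h₁, h₂, Prod.swap_injective h₃⟩)
    (fun e he hc f hf hc' hef x hx => by
      rw [hblue e he hc, hblue f hf hc'] at hx
      obtain ⟨v, h₁, h₂, h₃⟩ := h'.edgeTent_inter_edgeTent hL' ⟨he, fun hr => hc ⟨hr, he⟩⟩
        ⟨hf, fun hr => hc' ⟨hr, hf⟩⟩ hef hx.1 hx.2
      exact ⟨v, h₁, h₂, Prod.swap_injective h₃⟩)
  refine ⟨Γ, ⟨⟨?_, ?_, ?_⟩, planeR, planeB⟩, ?_, fun u v huv => ?_, ?_⟩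
  · intro u hu v hv huv
    exact h.eq_of_X_eq hu hv (congrArg Prod.fst huv)
  · rintro u v (huv | huv)
    · exact planeR.simple u v huv
    · exact planeB.simple u v huv
  · intro e he w hw
    rw [SimpleGraph.Subgraph.edgeSet_sup] at he
    rcases he with he | he
    · exact avoidR e he w hw
    · exact avoidB e he w hw
  · rintro u v ⟨huv | huv, hc⟩
    · exact bendR u v huv hc
    · exact bendB u v huv hc
  · rw [hcom _ huv, chord_mk]
  · have one_le_four : (1 : ℕ∞) ≤ 4 := by norm_num
    have mixed : ∀ e ∈ R.edgeSet, e ∉ commonEdges R B → ∀ f ∈ B.edgeSet, f ∉ commonEdges R B →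
        (Γ.curve e ∩ Γ.curve f).encard ≤ 4 := fun e he hc f hf hc' => by
      rw [hred e he hc, hblue f hf hc']
      exact h.encard_edgeTent_inter hL hL' he hf
    rintro e ⟨he | he, hc⟩ f ⟨hf | hf, hc'⟩ hef
    · exact (encard_le_one_of_noCross hef (planeR.noCross e he f hf hef)).trans one_le_four
    · exact mixed e he hc f hf hc'
    · rw [Set.inter_comm]
      exact mixed f hf hc' e he hc
    · exact (encard_le_one_of_noCross hef (planeB.noCross e he f hf hef)).trans one_le_four
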